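/- **Conventions.** Let $A$ be a C*-algebra (not necessarily unital) and $V$ a finitely generated projective Hilbert $A$-module, i.e. $V\cong pA^m$ for some $m\in\mathbb N$ and a projection $p=p^2=p^*\in\mathcal L_A(A^m)$; $\mathcal L_A(V)$ is the C*-algebra of adjointable operators on $V$ with the operator norm, and $U(\mathcal L_A(V))$ its unitary group with the norm topology. An isomorphism of Hilbert $A$-modules is a bijective adjointable map preserving the $A$-valued inner product. A Hilbert $A$-module bundle modelled on $V$ is a fibre bundle with typical fibre $V$ and structure group $U(\mathcal L_A(V))$; isomorphisms and trivializations of such bundles are fibrewise isomorphisms of Hilbert $A$-modules which are norm-continuous in local charts. Let $X$ be an abstract simplicial complex, $X^{(k)}$ its $k$-skeleton, and $|X|$ its geometric realization with the weak topology. The closed simplex $|\sigma|$ carries the Euclidean metric $d_\sigma$ of the standard simplex (with edge length $\sqrt2$). A *family of trivializations* of a Hilbert $A$-module bundle $E\to|X|$ modelled on $V$ consists of a trivialization $\Phi_\sigma\colon|\sigma|\times V\to E|_{|\sigma|}$ for each simplex $\sigma$. For $\epsilon>0$ it is *$\epsilon$-flat* if for all simplices $\rho\subset\sigma$ the transition function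 $|\rho|\to U(\mathcal L_A(V))$, $x\mapsto\Phi_\rho(x,\cdot)^{-1}\Phi_\sigma(x,\cdot)$, is $\epsilon$-Lipschitz; an *$\epsilon$-flat bundle* is a bundle with an $\epsilon$-flat family of trivializations. An *extension* of a bundle with trivializations $(E,\Phi)$ over $|X^{(k)}|$ to $|X^{(k+1)}|$ is a bundle with trivializations $(E',\Phi')$ over $|X^{(k+1)}|$ together with an isomorphism $E\cong E'|_{|X^{(k)}|}$ that carries $\Phi_\sigma$ to $\Phi'_\sigma$ for every simplex $\sigma$ of $X^{(k)}$. Transport along an edge $\{p,q\}$ is $T_{(p,q)}=\Phi_{\{p,q\}}(q,\cdot)\,\Phi_{\{p,q\}}(p,\cdot)^{-1}\colon E_p\to E_q$. **Theorem.** All constants below are independent of $A$, of $V$ and of the bundles. 1. For every $k\in\mathbb N$ with $k\ne1$ there are constants $C=C(k)>0$ and $\delta=\delta(k)>0$ such that for every simplicial complex $X$ and every $0<\epsilon\le\delta$, every $\epsilon$-flat bundle over $|X^{(k)}|$ has an extension to a $C\epsilon$-flat bundle over $|X^{(k+1)}|$. 2. There are constants $C,\delta>0$ such that the following holds for every simplicial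 complex $X$ and every $0<\epsilon\le\delta$. Let $E\to|X^{(1)}|$ be a bundle with a family of trivializations such that $$\|T_{(r,p)}T_{(q,r)}T_{(p,q)}-\mathrm{id}_{E_p}\|\le\epsilon$$ for every 2-simplex $\{p,q,r\}$ of $X$ (and every ordering of its vertices). Then $E$ has an extension to a $C\epsilon$-flat bundle over $|X^{(2)}|$. 3. For every $n\in\mathbb N$ there are constants $C=C(n)>0$ and $\delta=\delta(n)>0$ such that the following holds for every simplicial complex $X$ of dimension at most $n$ and every $0<\epsilon\le\delta$. Let $E,E'\to|X|$ be two $\epsilon$-flat bundles modelled on the same $V$, with trivializations $\Phi_\sigma,\Phi'_\sigma$ and transports $T,T'$, and suppose that $$\|\Phi_{\{q\}}(q,\cdot)^{-1}T_{(p,q)}\Phi_{\{p\}}(p,\cdot)-\Phi'_{\{q\}}(q,\cdot)^{-1}T'_{(p,q)}\Phi'_{\{p\}}(p,\cdot)\|<\epsilon$$ for every $1$-simplex $\{p,q\}$ of $X$. Then there is an isomorphism of bundles $\Xi\colon E\to E'$ such that for every simplex $\sigma$ of $X$ the map $$|\sigma|\to U(\mathcal L_A(V)),\qquad x\mapsto\Phi'_\sigma(x,\cdot)^{-1}\,\Xi_x\,\Phi_\sigma(x,\cdot)$$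 is $C\epsilon$-Lipschitz. -/

import Mathlib

open scoped WithCStarModule

universe u v w

/-! ### Hilbert modules

Hilbert `A`-modules are Mathlib's `CStarModule A V`, with a complete norm. Mathlib's convention is
`⟪x, a • y⟫ = a * ⟪x, y⟫`; a right Hilbert `A`-module in the convention `⟨x, y a⟩ = ⟨x, y⟩ a` is the
same thing as a `CStarModule` over the opposite C⋆-algebra. -/

section HilbertModules

set_option linter.unusedSectionVars false

variable (A : Type v) [NonUnitalCStarAlgebra A] [PartialOrder A] [StarOrderedRing A]

/-- A map of Hilbert `A`-modules is adjointable if it has an adjoint. -/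
def IsAdjointable {V W : Type*} [NormedAddCommGroup V] [NormedSpace ℂ V] [SMul A V]
    [CStarModule A V] [NormedAddCommGroup W] [NormedSpace ℂ W] [SMul A W] [CStarModule A W]
    (f : V → W) : Prop :=
  ∃ g : W → V, ∀ v w, inner A (f v) w = inner A v (g w)

/-- Finitely generated projective Hilbert `A`-modules: those isomorphic to `p Aⁿ` for some
projection `p = p² = p*` in the adjointable operators on the standard Hilbert module `Aⁿ`.
The isomorphism is given as an inner product preserving map into `Aⁿ` with image `p Aⁿ`. -/
def IsFinProjHilbertModule (V : Type*) [NormedAddCommGroup V] [NormedSpace ℂ V] [SMul A V]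
    [CStarModule A V] : Prop :=
  ∃ (n : ℕ) (p : C⋆ᵐᵒᵈ(A, Fin n → A) →ₗ[ℂ] C⋆ᵐᵒᵈ(A, Fin n → A)),
    (∀ x, p (p x) = p x) ∧ (∀ x y, inner A (p x) y = inner A x (p y)) ∧
    ∃ f : V →ₗ[ℂ] C⋆ᵐᵒᵈ(A, Fin n → A),
      (∀ v w, inner A (f v) (f w) = inner A v w) ∧ LinearMap.range f = LinearMap.range p

/-- Isomorphisms of Hilbert `A`-modules: bijective maps which preserve the `A`-valued inner product.
They are automatically adjointable, the adjoint being the inverse, and `A`-linear. For `V = W` these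
are the unitary elements of the C⋆-algebra of adjointable operators on `V`. -/
structure HilbertModuleIso (V W : Type*) [NormedAddCommGroup V] [NormedSpace ℂ V] [SMul A V]
    [CStarModule A V] [NormedAddCommGroup W] [NormedSpace ℂ W] [SMul A W] [CStarModule A W]
    extends V ≃ₗ[ℂ] W where
  inner_map' : ∀ v w, inner A (toFun v) (toFun w) = inner A v w

namespace HilbertModuleIso

variable {A}
variable {U V W : Type*}
  [NormedAddCommGroup U] [NormedSpace ℂ U] [SMul A U] [CStarModule A U]
  [NormedAddCommGroup V] [NormedSpace ℂ V] [SMul A V] [CStarModule A V]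
  [NormedAddCommGroup W] [NormedSpace ℂ W] [SMul A W] [CStarModule A W]

instance : CoeFun (HilbertModuleIso A V W) (fun _ => V → W) := ⟨fun f => f.toLinearEquiv⟩

theorem inner_map (f : HilbertModuleIso A V W) (v w : V) :
    inner A (f v) (f w) = inner A v w := f.inner_map' v w

/-- The inverse isomorphism. -/
def symm (f : HilbertModuleIso A V W) : HilbertModuleIso A W V where
  toLinearEquiv := f.toLinearEquiv.symm
  inner_map' v w := by
    have h := f.inner_map (f.toLinearEquiv.symm v) (f.toLinearEquiv.symm w)
    simpa using h.symm

/-- The composition `g ∘ f`. -/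
def trans (f : HilbertModuleIso A U V) (g : HilbertModuleIso A V W) : HilbertModuleIso A U W where
  toLinearEquiv := f.toLinearEquiv.trans g.toLinearEquiv
  inner_map' v w := (g.inner_map (f v) (f w)).trans (f.inner_map v w)

theorem isAdjointable (f : HilbertModuleIso A V W) : IsAdjointable A f := by
  refine ⟨f.symm, fun v w => ?_⟩
  have h := f.inner_map v (f.symm w)
  rw [← h]
  congr 1
  exact (f.toLinearEquiv.apply_symm_apply w).symm

theorem map_smul (f : HilbertModuleIso A V W) (a : A) (v : V) : f (a • v) = a • f v := by
  have key : ∀ w : W, inner A w (f (a • v) - a • f v) = 0 := by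
    intro w
    have hw : w = f (f.symm w) := (f.toLinearEquiv.apply_symm_apply w).symm
    rw [CStarModule.inner_sub_right, CStarModule.inner_op_smul_right, hw, f.inner_map, f.inner_map,
      CStarModule.inner_op_smul_right, sub_self]
  exact sub_eq_zero.mp (CStarModule.inner_self.mp (key _))

theorem norm_map (f : HilbertModuleIso A V W) (v : V) : ‖f v‖ = ‖v‖ := by
  rw [CStarModule.norm_eq_sqrt_norm_inner_self (A := A) (f v),
    CStarModule.norm_eq_sqrt_norm_inner_self (A := A) v, f.inner_map]

/-- The underlying bounded operator; the norm used on adjointable operators is the operator norm. -/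
noncomputable def toCLM (f : HilbertModuleIso A V W) : V →L[ℂ] W :=
  (LinearIsometryEquiv.mk f.toLinearEquiv f.norm_map).toContinuousLinearEquiv.toContinuousLinearMap

@[simp] theorem toCLM_apply (f : HilbertModuleIso A V W) (v : V) : f.toCLM v = f v := rfl

end HilbertModuleIso

end HilbertModules

/-! ### Simplicial complexes and their geometric realization -/

namespace AbstractSimplicialComplex

variable {ι : Type u}

/-- The `k`-skeleton: all simplices of dimension at most `k`. -/
def skeleton (X : AbstractSimplicialComplex ι) (k : ℕ) : AbstractSimplicialComplex ι where
  faces := {σ | σ ∈ X ∧ σ.card ≤ k + 1}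
  isRelLowerSet_faces := by
    rintro σ ⟨hσ, hc⟩
    refine ⟨(X.isRelLowerSet_faces hσ).1, fun τ hτ hn => ?_⟩
    exact ⟨(X.isRelLowerSet_faces hσ).2 hτ hn, (Finset.card_le_card hτ).trans hc⟩
  singleton_mem p := ⟨X.singleton_mem p, by simp⟩

theorem skeleton_mono (X : AbstractSimplicialComplex ι) {k l : ℕ} (h : k ≤ l) :
    X.skeleton k ≤ X.skeleton l := fun _ hσ => ⟨hσ.1, hσ.2.trans (by omega)⟩

/-- The dimension of `X` is at most `n`. -/
def DimLE (X : AbstractSimplicialComplex ι) (n : ℕ) : Prop := ∀ σ ∈ X, σ.card ≤ n + 1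

/-- The underlying set of the geometric realization: formal convex combinations `∑ x_p p` of
vertices, those with non-zero coefficient forming a simplex. -/
def Realization (X : AbstractSimplicialComplex ι) : Type u :=
  {x : ι →₀ ℝ // (∀ p, 0 ≤ x p) ∧ x.support ∈ X ∧ (x.sum fun _ r => r) = 1}

namespace Realization

variable {X Y : AbstractSimplicialComplex ι}

/-- The closed simplex `|σ|` in the realization. -/
def face (X : AbstractSimplicialComplex ι) (σ : Finset ι) : Set X.Realization :=
  {x | x.1.support ⊆ σ}

theorem face_mono {ρ σ : Finset ι} (h : ρ ⊆ σ) : face X ρ ⊆ face X σ :=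
  fun _ hx => Finset.Subset.trans hx h

/-- The affine parametrization of `|σ|` by the standard simplex on the vertex set `σ`. -/
noncomputable def param (X : AbstractSimplicialComplex ι) (σ : Finset ι) (hσ : σ ∈ X)
    (t : stdSimplex ℝ σ) : X.Realization :=
  ⟨Finsupp.embDomain (Function.Embedding.subtype (· ∈ σ)) (Finsupp.equivFunOnFinite.symm t.1), by
    have hsum : ((Finsupp.embDomain (Function.Embedding.subtype (· ∈ σ))
        (Finsupp.equivFunOnFinite.symm t.1)).sum fun _ r => r) = 1 := by
      rw [Finsupp.sum_embDomain, Finsupp.sum_fintype _ _ (fun _ => rfl)]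
      exact t.2.2
    refine ⟨fun p => ?_, ?_, hsum⟩
    · by_cases hp : p ∈ σ
      · have := Finsupp.embDomain_apply_self (Function.Embedding.subtype (· ∈ σ))
          (Finsupp.equivFunOnFinite.symm t.1) ⟨p, hp⟩
        simp only [Function.Embedding.subtype_apply] at this
        rw [this]
        exact t.2.1 _
      · rw [Finsupp.embDomain_of_notMem_range]
        simpa using hp
    · refine (X.isRelLowerSet_faces hσ).2 ?_ ?_
      · intro p hp
        rw [Finsupp.support_embDomain, Finset.mem_map] at hp
        obtain ⟨q, -, rfl⟩ := hp
        exact q.2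
      · rw [Finsupp.support_nonempty_iff]
        intro h0
        rw [h0] at hsum
        simp at hsum⟩

/-- The weak topology: `U` is open if and only if its preimage in every simplex is open. -/
noncomputable instance : TopologicalSpace X.Realization :=
  ⨆ σ : {σ : Finset ι // σ ∈ X}, TopologicalSpace.coinduced (param X σ.1 σ.2) inferInstance

theorem isOpen_iff {U : Set X.Realization} :
    IsOpen U ↔ ∀ (σ : Finset ι) (hσ : σ ∈ X), IsOpen (param X σ hσ ⁻¹' U) := by
  rw [isOpen_iSup_iff]
  exact ⟨fun h σ hσ => h ⟨σ, hσ⟩, fun h σ => h σ.1 σ.2⟩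

/-- The Euclidean distance of two points of `|σ|`, for which `|σ|` is isometric to the standard
simplex in Euclidean space; distinct vertices have distance `√2`. -/
noncomputable def simplexDist (σ : Finset ι) (x y : X.Realization) : ℝ :=
  √(∑ p ∈ σ, (x.1 p - y.1 p) ^ 2)

/-- A vertex as a point of the realization. -/
noncomputable def vertex (X : AbstractSimplicialComplex ι) (p : ι) : X.Realization :=
  ⟨Finsupp.single p 1, by
    classical
    refine ⟨fun q => ?_, ?_, by simp⟩
    · rw [Finsupp.single_apply]
      split_ifs <;> norm_num
    · rw [Finsupp.support_single _ (one_ne_zero (α := ℝ))]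
      exact X.singleton_mem p⟩

theorem vertex_mem_face {p : ι} {σ : Finset ι} (hp : p ∈ σ) : vertex X p ∈ face X σ := by
  intro q hq
  have := Finsupp.support_single_subset hq
  rw [Finset.mem_singleton] at this
  exact this ▸ hp

/-- The inclusion of the realization of a subcomplex. -/
def incl (h : X ≤ Y) (x : X.Realization) : Y.Realization := ⟨x.1, x.2.1, h x.2.2.1, x.2.2.2⟩

theorem continuous_incl (h : X ≤ Y) : Continuous (incl h) := by
  refine ⟨fun U hU => ?_⟩
  rw [isOpen_iff] at hU ⊢
  exact fun σ hσ => hU σ (h hσ)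

end Realization

end AbstractSimplicialComplex

/-! ### Hilbert module bundles -/

/-- A Hilbert `A`-module bundle with typical fibre `V` over `B`: a vector bundle (in the sense of
Mathlib, so that the coordinate changes are continuous for the operator norm) whose fibres are
Hilbert `A`-modules and whose charts are fibrewise isomorphisms of Hilbert `A`-modules. Thus the
coordinate changes take values in the unitary group of the adjointable operators on `V`. -/
structure HilbertModuleBundle (A : Type v) [NonUnitalCStarAlgebra A] [PartialOrder A]
    [StarOrderedRing A] (V : Type w) [NormedAddCommGroup V] [NormedSpace ℂ V] [SMul A V]
    [CStarModule A V] (B : Type u) [TopologicalSpace B] where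
  Fiber : B → Type w
  [fiberNormedAddCommGroup : ∀ x, NormedAddCommGroup (Fiber x)]
  [fiberNormedSpace : ∀ x, NormedSpace ℂ (Fiber x)]
  [fiberSMul : ∀ x, SMul A (Fiber x)]
  [fiberCStarModule : ∀ x, CStarModule A (Fiber x)]
  [totalSpaceTopology : TopologicalSpace (Bundle.TotalSpace V Fiber)]
  [fiberBundle : FiberBundle V Fiber]
  [vectorBundle : VectorBundle ℂ V Fiber]
  inner_chart : ∀
    (e : Bundle.Trivialization V (Bundle.TotalSpace.proj : Bundle.TotalSpace V Fiber → B))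
    [MemTrivializationAtlas e] (x : B), x ∈ e.baseSet → ∀ v w : Fiber x,
      inner A (e ⟨x, v⟩).2 (e ⟨x, w⟩).2 = inner A v w

namespace HilbertModuleBundle

attribute [instance] fiberNormedAddCommGroup fiberNormedSpace fiberSMul fiberCStarModule
  totalSpaceTopology fiberBundle vectorBundle

variable {A : Type v} [NonUnitalCStarAlgebra A] [PartialOrder A] [StarOrderedRing A]
  {V : Type w} [NormedAddCommGroup V] [NormedSpace ℂ V] [SMul A V] [CStarModule A V]

section General

variable {B B' : Type u} [TopologicalSpace B] [TopologicalSpace B']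

/-- A trivialization `S × V → E|_S` over a subset `S` of the base: fibrewise isomorphisms of Hilbert
modules whose local expressions in the charts of `E` are continuous maps into the unitaries. -/
structure TrivializationOn (E : HilbertModuleBundle A V B) (S : Set B) where
  iso : ∀ x : S, HilbertModuleIso A V (E.Fiber x)
  continuousOn_iso : ∀ (e : Bundle.Trivialization V
      (Bundle.TotalSpace.proj : Bundle.TotalSpace V E.Fiber → B)) [MemTrivializationAtlas e],
    ContinuousOn (fun x : S => (e.continuousLinearMapAt ℂ (x : B)).comp (iso x).toCLM)
      {x : S | (x : B) ∈ e.baseSet}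

/-- An isomorphism from `E` onto the pull-back of `E'` along a continuous map `f`: fibrewise
isomorphisms `E_x → E'_{f x}` of Hilbert modules whose local expressions in charts are continuous
maps into the unitaries. -/
structure IsoOver (f : B → B') (E : HilbertModuleBundle A V B) (E' : HilbertModuleBundle A V B')
    where
  iso : ∀ x : B, HilbertModuleIso A (E.Fiber x) (E'.Fiber (f x))
  continuousOn_iso : ∀
    (e : Bundle.Trivialization V (Bundle.TotalSpace.proj : Bundle.TotalSpace V E.Fiber → B))
    (e' : Bundle.Trivialization V (Bundle.TotalSpace.proj : Bundle.TotalSpace V E'.Fiber → B'))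
    [MemTrivializationAtlas e] [MemTrivializationAtlas e'],
    ContinuousOn (fun x : B =>
        (e'.continuousLinearMapAt ℂ (f x)).comp ((iso x).toCLM.comp (e.symmL ℂ x)))
      (e.baseSet ∩ f ⁻¹' e'.baseSet)

end General

open AbstractSimplicialComplex Realization

variable {ι : Type u} {X Y : AbstractSimplicialComplex ι}

/-- A family of trivializations of a bundle over `|X|`, one over each simplex. -/
def TrivializationFamily (E : HilbertModuleBundle A V X.Realization) :=
  ∀ σ : {σ : Finset ι // σ ∈ X}, E.TrivializationOn (face X σ.1)

/-- The transition function `x ↦ Φ_ρ(x)⁻¹ ∘ Φ_σ(x)` for `ρ ⊆ σ`, on `|ρ|`. -/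
def transition {E : HilbertModuleBundle A V X.Realization} (Φ : E.TrivializationFamily)
    (ρ σ : {σ : Finset ι // σ ∈ X}) (h : ρ.1 ⊆ σ.1) (x : face X ρ.1) : HilbertModuleIso A V V :=
  ((Φ σ).iso ⟨x.1, face_mono h x.2⟩).trans ((Φ ρ).iso x).symm

/-- A family of trivializations is `ε`-flat if all transition functions are `ε`-Lipschitz. -/
def IsFlatFamily {E : HilbertModuleBundle A V X.Realization} (ε : ℝ)
    (Φ : E.TrivializationFamily) : Prop :=
  ∀ (ρ σ : {σ : Finset ι // σ ∈ X}) (h : ρ.1 ⊆ σ.1) (x y : face X ρ.1),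
    ‖(transition Φ ρ σ h x).toCLM - (transition Φ ρ σ h y).toCLM‖ ≤ ε * simplexDist ρ.1 x.1 y.1

/-- Transport `Φ_σ(q) ∘ Φ_σ(p)⁻¹ : E_p → E_q` along an edge `σ = {p, q}`. -/
noncomputable def transport [DecidableEq ι] {E : HilbertModuleBundle A V X.Realization}
    (Φ : E.TrivializationFamily) (p q : ι) (h : {p, q} ∈ X) :
    HilbertModuleIso A (E.Fiber (vertex X p)) (E.Fiber (vertex X q)) :=
  ((Φ ⟨{p, q}, h⟩).iso ⟨vertex X p, vertex_mem_face (by simp)⟩).symm.trans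
    ((Φ ⟨{p, q}, h⟩).iso ⟨vertex X q, vertex_mem_face (by simp)⟩)

/-- The trivialization `V → E_p` over a vertex `p`. -/
noncomputable def vertexIso {E : HilbertModuleBundle A V X.Realization}
    (Φ : E.TrivializationFamily) (p : ι) : HilbertModuleIso A V (E.Fiber (vertex X p)) :=
  (Φ ⟨{p}, X.singleton_mem p⟩).iso ⟨vertex X p, vertex_mem_face (by simp)⟩

/-- Edge transport `Φ_q(q)⁻¹ ∘ T_{[p,q]} ∘ Φ_p(p) : V → V` in terms of the trivializations over the
two vertices. -/
noncomputable def transportMatrix [DecidableEq ι] {E : HilbertModuleBundle A V X.Realization}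
    (Φ : E.TrivializationFamily) (p q : ι) (h : {p, q} ∈ X) : HilbertModuleIso A V V :=
  ((vertexIso Φ p).trans (transport Φ p q h)).trans (vertexIso Φ q).symm

/-- The bundle `E'` over `|Y|` with trivializations `Φ'` extends the bundle `E` over the subcomplex
`|X|` with trivializations `Φ`: there is an isomorphism of `E` with the restriction of `E'` which
carries `Φ_σ` to `Φ'_σ` for every simplex `σ` of `X`. -/
def IsExtension (hXY : X ≤ Y)
    (E : HilbertModuleBundle A V X.Realization) (Φ : E.TrivializationFamily)
    (E' : HilbertModuleBundle A V Y.Realization) (Φ' : E'.TrivializationFamily) : Prop :=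
  ∃ θ : IsoOver (incl hXY) E E',
    ∀ (σ : {σ : Finset ι // σ ∈ X}) (x : face X σ.1) (v : V),
      θ.iso x.1 ((Φ σ).iso x v) = (Φ' ⟨σ.1, hXY σ.2⟩).iso ⟨incl hXY x.1, x.2⟩ v

/-- The local expression `Φ'_σ(x)⁻¹ ∘ Ξ_x ∘ Φ_σ(x)` of a bundle isomorphism over a simplex. -/
def localExpr {E E' : HilbertModuleBundle A V X.Realization} (Ξ : IsoOver id E E')
    (Φ : E.TrivializationFamily) (Φ' : E'.TrivializationFamily)
    (σ : {σ : Finset ι // σ ∈ X}) (x : face X σ.1) : HilbertModuleIso A V V :=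
  (((Φ σ).iso x).trans (Ξ.iso x.1)).trans ((Φ' σ).iso x).symm

end HilbertModuleBundle

/-! At every point `x`, take as reference the trivialization over the open simplex containing `x`
(`supportFrame`). It jumps from cell to cell, but relative to it each trivialization `Φ_σ` becomes a
function `φ_σ` with values in the unitary group `G` of `V`, and the transition functions become
`φ_ρ⁻¹ φ_σ`. The problem is then about `G`-valued functions on simplices, and the norm metric of `G`
is bi-invariant.

The engine is `exists_lipschitz_gauge`. Given two flat families `φ`, `φ'` and values `γ₀` at the
vertices that almost intertwine the edge transports, it yields `γ` such that `φ'_σ⁻¹ γ φ_σ` is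
`O(ε)`-Lipschitz on every simplex. The construction is by induction over skeleta. On the boundary of
a simplex of dimension at least two the expression is Lipschitz on each facet, by induction and
flatness, hence on the whole boundary. On the two endpoints of an edge it is controlled by
hypothesis. Its values are close together, so after a translation they lie in the Cayley chart at
the identity, where they are coned off linearly from the barycentre. The Cayley estimates are
universal, so the constants depend only on the dimension.

Uniqueness is the case `γ₀ = 1`: in the reference frames, `γ` is the isomorphism. For the extension,
the engine with `φ = 1` on the boundary of each `(k + 1)`-simplex gives a trivialization of `E`
there that is almost constant in the given frames. It serves as clutching function for gluing in the
trivial bundle over the simplex (`exists_extension`, `exists_flat_extension`). The vertex values are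
transported from one vertex of the simplex, and their defect along an edge is the holonomy of a
triangle. This is small by flatness over the triangle if `k ≥ 2` and by assumption if `k = 1`; for
`k = 0` there are no edges. -/

namespace HilbertModuleIso

/-! ### The unitary group of a Hilbert module as a metric group. -/

section Comp

variable {A : Type v} [NonUnitalCStarAlgebra A] [PartialOrder A] [StarOrderedRing A]
variable {U V W : Type*}
  [NormedAddCommGroup U] [NormedSpace ℂ U] [SMul A U] [CStarModule A U]
  [NormedAddCommGroup V] [NormedSpace ℂ V] [SMul A V] [CStarModule A V]
  [NormedAddCommGroup W] [NormedSpace ℂ W] [SMul A W] [CStarModule A W]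

set_option linter.unusedSectionVars false in
@[ext]
theorem ext {f g : HilbertModuleIso A V W} (h : ∀ v, f v = g v) : f = g := by
  cases f; cases g
  congr
  exact LinearEquiv.ext h

@[simp] theorem trans_apply (f : HilbertModuleIso A U V) (g : HilbertModuleIso A V W) (v : U) :
    f.trans g v = g (f v) := rfl

@[simp] theorem symm_apply_apply (f : HilbertModuleIso A V W) (v : V) : f.symm (f v) = v :=
  f.toLinearEquiv.symm_apply_apply v

@[simp] theorem apply_symm_apply (f : HilbertModuleIso A V W) (v : W) : f (f.symm v) = v :=
  f.toLinearEquiv.apply_symm_apply v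

theorem toCLM_trans (f : HilbertModuleIso A U V) (g : HilbertModuleIso A V W) :
    (f.trans g).toCLM = g.toCLM.comp f.toCLM := rfl

/-- Conjugation by an isomorphism does not increase the distance to the identity. -/
theorem norm_conj_sub_id_le (f : HilbertModuleIso A V W) (T : HilbertModuleIso A W W) :
    ‖((f.trans T).trans f.symm).toCLM - ContinuousLinearMap.id ℂ V‖ ≤
      ‖T.toCLM - ContinuousLinearMap.id ℂ W‖ := by
  refine ContinuousLinearMap.opNorm_le_bound _ (norm_nonneg _) fun v => ?_
  have h1 : (((f.trans T).trans f.symm).toCLM - ContinuousLinearMap.id ℂ V) v =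
      f.symm ((T.toCLM - ContinuousLinearMap.id ℂ W) (f v)) := by
    simp only [sub_apply, toCLM_apply, trans_apply, ContinuousLinearMap.id_apply, map_sub,
      symm_apply_apply]
  rw [h1, norm_map]
  refine (ContinuousLinearMap.le_opNorm _ _).trans ?_
  rw [norm_map]

end Comp

section Group

variable {A : Type v} [NonUnitalCStarAlgebra A] [PartialOrder A] [StarOrderedRing A]
  {V : Type w} [NormedAddCommGroup V] [NormedSpace ℂ V] [SMul A V] [CStarModule A V]

/-- The unitary group of the adjointable operators on `V`. -/
instance : Group (HilbertModuleIso A V V) where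
  mul f g := g.trans f
  one := ⟨LinearEquiv.refl ℂ V, fun _ _ => rfl⟩
  inv f := f.symm
  mul_assoc _ _ _ := rfl
  one_mul _ := rfl
  mul_one _ := rfl
  inv_mul_cancel f := ext fun v => f.symm_apply_apply v

@[simp] theorem mul_apply (f g : HilbertModuleIso A V V) (v : V) : (f * g) v = f (g v) := rfl

@[simp] theorem one_apply (v : V) : (1 : HilbertModuleIso A V V) v = v := rfl

theorem toCLM_one : (1 : HilbertModuleIso A V V).toCLM = 1 := rfl

theorem toCLM_injective : Function.Injective (toCLM : HilbertModuleIso A V V → V →L[ℂ] V) :=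
  fun _ _ h => ext fun v => DFunLike.congr_fun h v

noncomputable instance : MetricSpace (HilbertModuleIso A V V) :=
  MetricSpace.induced toCLM toCLM_injective inferInstance

theorem dist_def (f g : HilbertModuleIso A V V) : dist f g = ‖f.toCLM - g.toCLM‖ :=
  dist_eq_norm f.toCLM g.toCLM

theorem isometry_toCLM : Isometry (toCLM : HilbertModuleIso A V V → V →L[ℂ] V) :=
  Isometry.of_dist_eq fun _ _ => rfl

theorem dist_mul_left_le (f g h : HilbertModuleIso A V V) : dist (f * g) (f * h) ≤ dist g h := by
  rw [dist_def, dist_def]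
  refine ContinuousLinearMap.opNorm_le_bound _ (norm_nonneg _) fun v => ?_
  have h1 : ((f * g).toCLM - (f * h).toCLM) v = f ((g.toCLM - h.toCLM) v) := by
    simp
  rw [h1, norm_map]
  exact ContinuousLinearMap.le_opNorm _ _

theorem dist_mul_right_le (f g h : HilbertModuleIso A V V) : dist (g * f) (h * f) ≤ dist g h := by
  rw [dist_def, dist_def]
  refine ContinuousLinearMap.opNorm_le_bound _ (norm_nonneg _) fun v => ?_
  have h1 : ((g * f).toCLM - (h * f).toCLM) v = (g.toCLM - h.toCLM) (f v) := by
    simp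
  rw [h1]
  refine (ContinuousLinearMap.le_opNorm _ _).trans ?_
  rw [norm_map]

instance : IsIsometricSMul (HilbertModuleIso A V V) (HilbertModuleIso A V V) where
  isometry_smul f := Isometry.of_dist_eq fun g h => by
    refine le_antisymm (dist_mul_left_le f g h) ?_
    simpa using dist_mul_left_le f⁻¹ (f * g) (f * h)

instance : IsIsometricSMul (HilbertModuleIso A V V)ᵐᵒᵖ (HilbertModuleIso A V V) where
  isometry_smul f := Isometry.of_dist_eq fun g h => by
    refine le_antisymm (dist_mul_right_le f.unop g h) ?_
    simpa using dist_mul_right_le f.unop⁻¹ (g * f.unop) (h * f.unop)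

end Group

end HilbertModuleIso

/-! ### Groups with a bi-invariant metric. -/

section BiInvariant

variable {G : Type*} [Group G] [MetricSpace G] [IsIsometricSMul G G] [IsIsometricSMul Gᵐᵒᵖ G]

theorem dist_mul_mul_le_of_biInvariant (a b c d : G) :
    dist (a * b) (c * d) ≤ dist a c + dist b d := by
  calc dist (a * b) (c * d) ≤ dist (a * b) (c * b) + dist (c * b) (c * d) := dist_triangle _ _ _
    _ = dist a c + dist b d := by rw [dist_mul_right, dist_mul_left]

theorem dist_inv_inv_of_biInvariant (a b : G) : dist a⁻¹ b⁻¹ = dist a b := by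
  rw [← dist_mul_left a, ← dist_mul_right _ _ b]
  simp [dist_comm]

instance isTopologicalGroup_of_biInvariant : IsTopologicalGroup G where
  continuous_mul := by
    have : LipschitzWith 2 (fun p : G × G => p.1 * p.2) := by
      refine LipschitzWith.of_dist_le_mul fun p q => ?_
      refine (dist_mul_mul_le_of_biInvariant _ _ _ _).trans ?_
      have h1 : dist p.1 q.1 ≤ dist p q := le_max_left _ _
      have h2 : dist p.2 q.2 ≤ dist p q := le_max_right _ _
      push_cast
      linarith
    exact this.continuous
  continuous_inv := (Isometry.of_dist_eq dist_inv_inv_of_biInvariant).continuous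

/-- A chart at the identity: a map `c` from a real normed space to `G` which is a one-sided inverse
of a map `l`, with uniform Lipschitz constants on balls of radius `1 / 2`. -/
def HasLipschitzChartAtOne (G : Type w) [Group G] [MetricSpace G] : Prop :=
  ∃ (K : Type w) (_ : NormedAddCommGroup K) (_ : NormedSpace ℝ K) (c : K → G) (l : G → K),
    l 1 = 0 ∧ (∀ g, dist g 1 ≤ 1 / 2 → c (l g) = g) ∧
    (∀ g h, dist g 1 ≤ 1 / 2 → dist h 1 ≤ 1 / 2 → ‖l g - l h‖ ≤ 2 * dist g h) ∧
    ∀ a b, ‖a‖ ≤ 1 / 2 → ‖b‖ ≤ 1 / 2 → dist (c a) (c b) ≤ 8 * ‖a - b‖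

end BiInvariant

/-! ### The Cayley transform as a chart of the unitary group. -/

section Cayley

theorem exists_inverse_one_sub {R : Type*} [NormedRing R] [CompleteSpace R] {k : R}
    (hk : ‖k‖ ≤ 1 / 2) : ∃ r : R, (1 - k) * r = 1 ∧ r * (1 - k) = 1 :=
  ⟨((Units.oneSub k (by linarith))⁻¹ : Rˣ), (Units.oneSub k (by linarith)).mul_inv,
    (Units.oneSub k (by linarith)).inv_mul⟩

variable {A : Type v} [NonUnitalCStarAlgebra A] [PartialOrder A] [StarOrderedRing A]
  {V : Type w} [NormedAddCommGroup V] [NormedSpace ℂ V] [SMul A V] [CStarModule A V]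

variable (A V) in
/-- The real vector space of skew-adjoint operators. -/
def skewOperators : Submodule ℝ (V →L[ℂ] V) where
  carrier := {k | ∀ v w, inner A (k v) w = -inner A v (k w)}
  add_mem' {a b} ha hb v w := by
    simp only [Set.mem_ofPred_eq] at ha hb
    simp [ha, hb, add_comm]
  zero_mem' v w := by simp
  smul_mem' r a ha v w := by
    simp only [Set.mem_ofPred_eq] at ha
    simp [ha]

set_option linter.unusedSectionVars false in
theorem mem_skewOperators {k : V →L[ℂ] V} :
    k ∈ skewOperators A V ↔ ∀ v w, inner A (k v) w = -inner A v (k w) := Iff.rfl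

/-- The unitary is the Cayley transform `(1 + k)(1 - k)⁻¹`. Compared with the exponential, it needs
only a Neumann series and makes the Lipschitz constants explicit. -/
theorem HilbertModuleIso.exists_of_skew [CompleteSpace V] {k : V →L[ℂ] V}
    (hk : k ∈ skewOperators A V) (hn : ‖k‖ ≤ 1 / 2) :
    ∃ u : HilbertModuleIso A V V, u.toCLM * (1 - k) = 1 + k := by
  obtain ⟨r, h1, h2⟩ := exists_inverse_one_sub hn
  obtain ⟨s, h3, h4⟩ := exists_inverse_one_sub (k := -k) (by rwa [norm_neg])
  rw [sub_neg_eq_add] at h3 h4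
  have e1 : (1 + k) * r * ((1 - k) * s) = 1 := by
    rw [mul_assoc, ← mul_assoc r, h2, one_mul, h3]
  have e2 : (1 - k) * s * ((1 + k) * r) = 1 := by
    rw [mul_assoc, ← mul_assoc s, h4, one_mul, h1]
  rw [mem_skewOperators] at hk
  -- By skewness the mixed terms cancel on each side.
  have hin : ∀ v w, inner A ((1 + k) v) ((1 + k) w) = inner A ((1 - k) v) ((1 - k) w) := by
    intro v w
    simp [hk]
    abel
  refine ⟨⟨LinearEquiv.ofLinearMap ((1 + k) * r : V →L[ℂ] V).toLinearMap
    ((1 - k) * s : V →L[ℂ] V).toLinearMap ?_ ?_, ?_⟩, ?_⟩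
  · ext v; exact DFunLike.congr_fun e1 v
  · ext v; exact DFunLike.congr_fun e2 v
  · intro v w
    have hv : (1 - k) (r v) = v := DFunLike.congr_fun h1 v
    have hw : (1 - k) (r w) = w := DFunLike.congr_fun h1 w
    have := hin (r v) (r w)
    rw [hv, hw] at this
    exact this
  · have : (1 + k) * r * (1 - k) = 1 + k := by rw [mul_assoc, h2, mul_one]
    ext v
    exact DFunLike.congr_fun this v

/-- The inverse Cayley transform `(g - 1)(g + 1)⁻¹`; here `g + 1 = 2(1 - (1 - g)/2)` is invertible
because `g` is close to `1`. -/
theorem HilbertModuleIso.exists_skew [CompleteSpace V] {g : HilbertModuleIso A V V}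
    (hg : dist g 1 ≤ 1 / 2) : ∃ k ∈ skewOperators A V, k * (g.toCLM + 1) = g.toCLM - 1 := by
  rw [HilbertModuleIso.dist_def, HilbertModuleIso.toCLM_one] at hg
  have hn : ‖(2⁻¹ : ℂ) • (1 - g.toCLM)‖ ≤ 1 / 2 := by
    rw [norm_smul, norm_sub_rev]
    norm_num
    linarith
  obtain ⟨r, h1, h2⟩ := exists_inverse_one_sub hn
  have e0 : g.toCLM + 1 = (2 : ℂ) • (1 - (2⁻¹ : ℂ) • (1 - g.toCLM)) := by
    rw [smul_sub, smul_smul]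
    norm_num
    rw [two_smul]
    abel
  have e1 : (g.toCLM + 1) * ((2⁻¹ : ℂ) • r) = 1 := by
    rw [e0, smul_mul_smul_comm, h1]; norm_num
  have e2 : ((2⁻¹ : ℂ) • r) * (g.toCLM + 1) = 1 := by
    rw [e0, smul_mul_smul_comm, h2]; norm_num
  set t := (2⁻¹ : ℂ) • r
  refine ⟨(g.toCLM - 1) * t, ?_, by rw [mul_assoc, e2, mul_one]⟩
  intro v w
  have hv : (g.toCLM + 1) (t v) = v := DFunLike.congr_fun e1 v
  have hw : (g.toCLM + 1) (t w) = w := DFunLike.congr_fun e1 w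
  have key : ∀ a b, inner A ((g.toCLM - 1) a) ((g.toCLM + 1) b) =
      -inner A ((g.toCLM + 1) a) ((g.toCLM - 1) b) := by
    intro a b
    simp [g.inner_map]
    abel
  have := key (t v) (t w)
  rw [hv, hw] at this
  exact this

/-- Write `2x = x(g + 1) - x(g - 1)` and absorb the second term. This allows `g + 1` to be cancelled
in the Cayley equation with control of norms. -/
theorem norm_le_of_mul_add_one {g : HilbertModuleIso A V V} (hg : dist g 1 ≤ 1 / 2)
    (x : V →L[ℂ] V) : 3 / 2 * ‖x‖ ≤ ‖x * (g.toCLM + 1)‖ := by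
  rw [HilbertModuleIso.dist_def, HilbertModuleIso.toCLM_one] at hg
  have h1 : (2 : ℂ) • x = x * (g.toCLM + 1) - x * (g.toCLM - 1) := by
    rw [two_smul]; noncomm_ring
  have h2 : 2 * ‖x‖ ≤ ‖x * (g.toCLM + 1)‖ + ‖x‖ * (1 / 2) := by
    calc 2 * ‖x‖ = ‖(2 : ℂ) • x‖ := by rw [norm_smul]; norm_num
      _ ≤ ‖x * (g.toCLM + 1)‖ + ‖x * (g.toCLM - 1)‖ := by rw [h1]; exact norm_sub_le _ _
      _ ≤ _ := by
        gcongr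
        exact (norm_mul_le _ _).trans (by gcongr)
  linarith

theorem HilbertModuleIso.hasLipschitzChartAtOne [CompleteSpace V] :
    HasLipschitzChartAtOne (HilbertModuleIso A V V) := by
  classical
  choose! l hlK hl using fun (g : HilbertModuleIso A V V) (hg : dist g 1 ≤ 1 / 2) =>
    HilbertModuleIso.exists_skew hg
  choose! c hc using fun (k : V →L[ℂ] V) (hk : k ∈ skewOperators A V ∧ ‖k‖ ≤ 1 / 2) =>
    HilbertModuleIso.exists_of_skew hk.1 hk.2
  have norm_one_le : ‖(1 : V →L[ℂ] V)‖ ≤ 1 := ContinuousLinearMap.norm_id_le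
  have hlip : ∀ g h : HilbertModuleIso A V V, dist g 1 ≤ 1 / 2 → dist h 1 ≤ 1 / 2 →
      ‖l g - l h‖ ≤ dist g h := by
    intro g h hg hh
    have b1 : 3 / 2 * ‖1 - l h‖ ≤ 2 := by
      refine (norm_le_of_mul_add_one hh _).trans ?_
      have : (1 - l h) * (h.toCLM + 1) = (2 : ℂ) • 1 := by
        rw [sub_mul, hl h hh, two_smul]; noncomm_ring
      rw [this, norm_smul]
      norm_num
      linarith
    have b2 := norm_le_of_mul_add_one hg (l g - l h)
    -- Subtract the two Cayley equations. The factor `1 - l h` has norm at most `4/3` by `b1`.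
    have : (l g - l h) * (g.toCLM + 1) = (1 - l h) * (g.toCLM - h.toCLM) := by
      have e1 := hl g hg
      have e2 := hl h hh
      calc (l g - l h) * (g.toCLM + 1) = l g * (g.toCLM + 1) - l h * (h.toCLM + 1)
            - l h * (g.toCLM - h.toCLM) := by noncomm_ring
        _ = _ := by rw [e1, e2]; noncomm_ring
    rw [this] at b2
    have b3 : ‖(1 - l h) * (g.toCLM - h.toCLM)‖ ≤ 4 / 3 * dist g h := by
      rw [HilbertModuleIso.dist_def]
      refine (norm_mul_le _ _).trans ?_
      gcongr
      linarith
    have := dist_nonneg (x := g) (y := h)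
    linarith
  have l1 : l 1 = 0 := by
    have h0 : dist (1 : HilbertModuleIso A V V) 1 ≤ 1 / 2 := by simp
    have := norm_le_of_mul_add_one h0 (l 1)
    rw [hl 1 h0, HilbertModuleIso.toCLM_one, sub_self, norm_zero] at this
    exact norm_le_zero_iff.1 (by linarith)
  refine ⟨skewOperators A V, inferInstance, inferInstance, fun k => c k.1,
    fun g => if h : dist g 1 ≤ 1 / 2 then ⟨l g, hlK g h⟩ else 0, ?_, ?_, ?_, ?_⟩
  · beta_reduce
    rw [dif_pos (by simp)]
    exact Subtype.ext l1
  · intro g hg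
    beta_reduce
    rw [dif_pos hg]
    have hn : ‖l g‖ ≤ 1 / 2 := by
      have := hlip g 1 hg (by simp)
      rw [l1, sub_zero] at this
      linarith
    have h1 := hc (l g) ⟨hlK g hg, hn⟩
    have h2 := hl g hg
    apply HilbertModuleIso.toCLM_injective
    -- Multiplying `c (l g) (1 - l g) = 1 + l g` on the right by `g + 1` gives `2 c (l g) = 2 g`.
    have e1 : (1 - l g) * (g.toCLM + 1) = (2 : ℂ) • 1 := by
      rw [sub_mul, h2, two_smul]; noncomm_ring
    have e2 : (1 + l g) * (g.toCLM + 1) = (2 : ℂ) • g.toCLM := by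
      rw [add_mul, h2, two_smul]; noncomm_ring
    have e3 : (2 : ℂ) • (c (l g)).toCLM = (2 : ℂ) • g.toCLM := by
      rw [← e2, ← h1, mul_assoc, e1, mul_smul_comm, mul_one]
    exact smul_right_injective _ (two_ne_zero (α := ℂ)) e3
  · intro g h hg hh
    beta_reduce
    rw [dif_pos hg, dif_pos hh]
    have := hlip g h hg hh
    have := dist_nonneg (x := g) (y := h)
    change ‖l g - l h‖ ≤ _
    linarith
  · intro a b ha hb
    have h1 := hc a.1 ⟨a.2, ha⟩
    have h2 := hc b.1 ⟨b.2, hb⟩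
    change dist (c a.1) (c b.1) ≤ 8 * ‖a.1 - b.1‖
    have ha' : ‖a.1‖ ≤ 1 / 2 := ha
    rw [HilbertModuleIso.dist_def]
    generalize a.1 = x at *
    generalize b.1 = y at *
    have hb1 : ‖(c y).toCLM‖ ≤ 1 :=
      ContinuousLinearMap.opNorm_le_bound _ zero_le_one fun v => by
        rw [HilbertModuleIso.toCLM_apply, HilbertModuleIso.norm_map, one_mul]
    -- Since `‖x‖ ≤ 1/2`, the last summand can be absorbed into the left-hand side, which leaves the
    -- bound `4‖x - y‖`.
    have e : (c x).toCLM - (c y).toCLM =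
        (x - y) + (c y).toCLM * (x - y) + ((c x).toCLM - (c y).toCLM) * x := by
      calc (c x).toCLM - (c y).toCLM = (c x).toCLM * (1 - x) - (c y).toCLM * (1 - y)
            + (c y).toCLM * (x - y) + ((c x).toCLM - (c y).toCLM) * x := by noncomm_ring
        _ = _ := by rw [h1, h2]; noncomm_ring
    have b1 : ‖(c x).toCLM - (c y).toCLM‖ ≤
        ‖x - y‖ + 1 * ‖x - y‖ + ‖(c x).toCLM - (c y).toCLM‖ * (1 / 2) := by
      conv_lhs => rw [e]
      refine (norm_add_le _ _).trans (add_le_add ((norm_add_le _ _).trans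
        (add_le_add le_rfl ((norm_mul_le _ _).trans ?_))) ((norm_mul_le _ _).trans ?_))
      · gcongr
      · gcongr
    have := norm_nonneg (x - y)
    linarith

end Cayley

/-! ### Barycentric coordinates and the radial projection of a simplex. -/

section Barycentric

variable {ι : Type u}

/-- The standard simplex on the vertex set `σ`, as a set of functions on all vertices. -/
def simplexPoints (σ : Finset ι) : Set (ι → ℝ) :=
  {x | (∀ p, 0 ≤ x p) ∧ (∀ p, p ∉ σ → x p = 0) ∧ ∑ p ∈ σ, x p = 1}

/-- The boundary of the standard simplex. -/
def simplexBoundary (σ : Finset ι) : Set (ι → ℝ) :=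
  {x | x ∈ simplexPoints σ ∧ ∃ p ∈ σ, x p = 0}

/-- The `ℓ¹`-distance of the barycentric coordinates. -/
def l1Dist (σ : Finset ι) (x y : ι → ℝ) : ℝ := ∑ p ∈ σ, |x p - y p|

/-- The least barycentric coordinate. -/
noncomputable def lowest (σ : Finset ι) (x : ι → ℝ) : ℝ :=
  if h : σ.Nonempty then σ.inf' h x else 0

/-- One minus the coefficient of the barycentre, when `x` is written as a convex combination of the
barycentre and a boundary point. -/
noncomputable def radialScale (σ : Finset ι) (x : ι → ℝ) : ℝ := 1 - σ.card * lowest σ x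

/-- The radial projection from the barycentre to the boundary. -/
noncomputable def radial (σ : Finset ι) (x : ι → ℝ) : ι → ℝ :=
  (σ : Set ι).indicator fun p => (x p - lowest σ x) / radialScale σ x

variable {σ τ : Finset ι} {x y z : ι → ℝ}

theorem mem_simplexPoints_of_subset (h : τ ⊆ σ) :
    x ∈ simplexPoints τ ↔ x ∈ simplexPoints σ ∧ ∀ p, p ∉ τ → x p = 0 := by
  constructor
  · rintro ⟨h0, h1, h2⟩
    refine ⟨⟨h0, fun p hp => h1 p fun hp' => hp (h hp'), ?_⟩, h1⟩
    rw [← h2]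
    exact (Finset.sum_subset h fun p _ hp => h1 p hp).symm
  · rintro ⟨⟨h0, h1, h2⟩, h3⟩
    refine ⟨h0, h3, ?_⟩
    rw [← h2]
    exact Finset.sum_subset h fun p _ hp => h3 p hp

theorem l1Dist_nonneg : 0 ≤ l1Dist σ x y := Finset.sum_nonneg fun _ _ => abs_nonneg _

theorem l1Dist_comm : l1Dist σ x y = l1Dist σ y x :=
  Finset.sum_congr rfl fun _ _ => abs_sub_comm _ _

theorem l1Dist_triangle : l1Dist σ x z ≤ l1Dist σ x y + l1Dist σ y z := by
  rw [l1Dist, l1Dist, l1Dist, ← Finset.sum_add_distrib]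
  exact Finset.sum_le_sum fun p _ => abs_sub_le _ _ _

theorem l1Dist_mono (h : τ ⊆ σ) : l1Dist τ x y ≤ l1Dist σ x y :=
  Finset.sum_le_sum_of_subset_of_nonneg h fun _ _ _ => abs_nonneg _

theorem abs_sub_le_l1Dist {p : ι} (hp : p ∈ σ) : |x p - y p| ≤ l1Dist σ x y :=
  Finset.single_le_sum (f := fun p => |x p - y p|) (fun _ _ => abs_nonneg _) hp

theorem l1Dist_le_two (hx : x ∈ simplexPoints σ) (hy : y ∈ simplexPoints σ) :
    l1Dist σ x y ≤ 2 := by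
  calc l1Dist σ x y ≤ ∑ p ∈ σ, (x p + y p) := Finset.sum_le_sum fun p _ => by
        rw [abs_le]; constructor <;> linarith [hx.1 p, hy.1 p]
    _ = 2 := by rw [Finset.sum_add_distrib, hx.2.2, hy.2.2]; norm_num

theorem nonempty_of_mem_simplexPoints (hx : x ∈ simplexPoints σ) : σ.Nonempty := by
  rw [Finset.nonempty_iff_ne_empty]
  rintro rfl
  simpa using hx.2.2

theorem lowest_le {p : ι} (hp : p ∈ σ) : lowest σ x ≤ x p := by
  rw [lowest, dif_pos ⟨p, hp⟩]
  exact Finset.inf'_le _ hp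

theorem exists_eq_lowest (h : σ.Nonempty) (x : ι → ℝ) : ∃ p ∈ σ, lowest σ x = x p := by
  rw [lowest, dif_pos h]
  exact Finset.exists_mem_eq_inf' h x

theorem lowest_nonneg (hx : x ∈ simplexPoints σ) : 0 ≤ lowest σ x := by
  obtain ⟨p, -, hp⟩ := exists_eq_lowest (nonempty_of_mem_simplexPoints hx) x
  rw [hp]
  exact hx.1 p

theorem abs_lowest_sub_le : |lowest σ x - lowest σ y| ≤ l1Dist σ x y := by
  rcases σ.eq_empty_or_nonempty with rfl | h
  · simp [lowest, l1Dist]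
  obtain ⟨p, hp, hpx⟩ := exists_eq_lowest h x
  obtain ⟨q, hq, hqy⟩ := exists_eq_lowest h y
  have h1 := lowest_le (x := x) hq
  have h2 := lowest_le (x := y) hp
  have h3 := abs_le.1 (abs_sub_le_l1Dist (x := x) (y := y) hp)
  have h4 := abs_le.1 (abs_sub_le_l1Dist (x := x) (y := y) hq)
  rw [abs_le]
  constructor <;> linarith

theorem radialScale_nonneg (hx : x ∈ simplexPoints σ) : 0 ≤ radialScale σ x := by
  have : ∑ _p ∈ σ, lowest σ x ≤ ∑ p ∈ σ, x p := Finset.sum_le_sum fun p hp => lowest_le hp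
  rw [hx.2.2, Finset.sum_const, nsmul_eq_mul] at this
  rw [radialScale]
  linarith

theorem radialScale_le_one (hx : x ∈ simplexPoints σ) : radialScale σ x ≤ 1 := by
  have := lowest_nonneg hx
  rw [radialScale]
  nlinarith [Nat.cast_nonneg (α := ℝ) σ.card]

theorem lowest_eq_zero (hx : x ∈ simplexBoundary σ) : lowest σ x = 0 := by
  obtain ⟨p, hp, h0⟩ := hx.2
  exact le_antisymm (h0 ▸ lowest_le hp) (lowest_nonneg hx.1)

theorem radialScale_eq_one (hx : x ∈ simplexBoundary σ) : radialScale σ x = 1 := by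
  rw [radialScale, lowest_eq_zero hx, mul_zero, sub_zero]

theorem radial_apply {p : ι} (hp : p ∈ σ) :
    radial σ x p = (x p - lowest σ x) / radialScale σ x := by
  rw [radial, Set.indicator_of_mem (Finset.mem_coe.2 hp)]

theorem radial_eq_self (hx : x ∈ simplexBoundary σ) : radial σ x = x := by
  funext p
  by_cases hp : p ∈ σ
  · rw [radial_apply hp, radialScale_eq_one hx, lowest_eq_zero hx, sub_zero, div_one]
  · rw [radial, Set.indicator_of_notMem (by simpa using hp), hx.1.2.1 p hp]

theorem radialScale_mul_radial {p : ι} (hp : p ∈ σ) (h : radialScale σ x ≠ 0) :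
    radialScale σ x * radial σ x p = x p - lowest σ x := by
  rw [radial_apply hp]
  field_simp

theorem radial_mem_simplexBoundary (hx : x ∈ simplexPoints σ) (h : radialScale σ x ≠ 0) :
    radial σ x ∈ simplexBoundary σ := by
  have hpos : 0 < radialScale σ x := lt_of_le_of_ne (radialScale_nonneg hx) h.symm
  refine ⟨⟨fun p => ?_, fun p hp => ?_, ?_⟩, ?_⟩
  · by_cases hp : p ∈ σ
    · rw [radial_apply hp]
      exact div_nonneg (sub_nonneg.2 (lowest_le hp)) hpos.le
    · rw [radial, Set.indicator_of_notMem (by simpa using hp)]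
  · rw [radial, Set.indicator_of_notMem (by simpa using hp)]
  · rw [Finset.sum_congr rfl fun p hp => radial_apply hp, ← Finset.sum_div,
      Finset.sum_sub_distrib, hx.2.2, Finset.sum_const, nsmul_eq_mul]
    exact div_self h
  · obtain ⟨p, hp, hpx⟩ := exists_eq_lowest (nonempty_of_mem_simplexPoints hx) x
    refine ⟨p, hp, ?_⟩
    rw [radial_apply hp, hpx, sub_self, zero_div]

theorem sum_simplexPoints_abs (hx : x ∈ simplexPoints σ) : ∑ p ∈ σ, |x p| = 1 := by
  rw [← hx.2.2]
  exact Finset.sum_congr rfl fun p _ => abs_of_nonneg (hx.1 p)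

theorem abs_radialScale_sub_le :
    |radialScale σ x - radialScale σ y| ≤ σ.card * l1Dist σ x y := by
  have : radialScale σ x - radialScale σ y = σ.card * (lowest σ y - lowest σ x) := by
    rw [radialScale, radialScale]; ring
  rw [this, abs_mul, Nat.abs_cast, l1Dist_comm]
  exact mul_le_mul_of_nonneg_left abs_lowest_sub_le (Nat.cast_nonneg _)

/-- The projection degenerates at the barycentre, but `radialScale σ x * radial σ x p = x p - lowest
σ x` is Lipschitz in `x`, and boundary points have `ℓ¹`-norm one. The scale and the lowest
coordinate each contribute `σ.card`. -/
theorem radialScale_mul_l1Dist_radial_le (hx : x ∈ simplexPoints σ) (hy : y ∈ simplexPoints σ)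
    (h : radialScale σ x ≠ 0) (h' : radialScale σ y ≠ 0) :
    radialScale σ y * l1Dist σ (radial σ x) (radial σ y) ≤ (2 * σ.card + 1) * l1Dist σ x y := by
  have h0 := radialScale_nonneg hy
  have hR := (radial_mem_simplexBoundary hx h).1
  calc radialScale σ y * l1Dist σ (radial σ x) (radial σ y)
      = ∑ p ∈ σ, |radialScale σ y * radial σ x p - radialScale σ y * radial σ y p| := by
        rw [l1Dist, Finset.mul_sum]
        refine Finset.sum_congr rfl fun p _ => ?_
        rw [← mul_sub, abs_mul, abs_of_nonneg h0]
    _ ≤ ∑ p ∈ σ, (|radialScale σ x - radialScale σ y| * |radial σ x p| + |x p - y p| +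
          |lowest σ x - lowest σ y|) := by
        refine Finset.sum_le_sum fun p hp => ?_
        have e : radialScale σ y * radial σ x p - radialScale σ y * radial σ y p =
            -((radialScale σ x - radialScale σ y) * radial σ x p) + (x p - y p) -
              (lowest σ x - lowest σ y) := by
          rw [radialScale_mul_radial hp h', sub_mul, radialScale_mul_radial hp h]
          ring
        rw [e]
        refine (abs_sub _ _).trans (add_le_add ((abs_add_le _ _).trans (add_le_add ?_ le_rfl)) le_rfl)
        rw [abs_neg, abs_mul]
    _ = |radialScale σ x - radialScale σ y| + l1Dist σ x y +
          σ.card * |lowest σ x - lowest σ y| := by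
        rw [Finset.sum_add_distrib, Finset.sum_add_distrib, ← Finset.mul_sum,
          sum_simplexPoints_abs hR, mul_one, Finset.sum_const, nsmul_eq_mul, l1Dist]
    _ ≤ σ.card * l1Dist σ x y + l1Dist σ x y + σ.card * l1Dist σ x y := by
        gcongr
        · exact abs_radialScale_sub_le
        · exact abs_lowest_sub_le
    _ = _ := by ring

/-- A function on the boundary of a simplex of dimension at least two which is Lipschitz on each
facet is Lipschitz. -/
theorem lipschitz_simplexBoundary_of_facets {M : Type*} [PseudoMetricSpace M] (hσ : 3 ≤ σ.card)
    {f : (ι → ℝ) → M} {L : ℝ} (hL : 0 ≤ L)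
    (hf : ∀ p ∈ σ, ∀ x ∈ simplexPoints σ, ∀ y ∈ simplexPoints σ, x p = 0 → y p = 0 →
      dist (f x) (f y) ≤ L * l1Dist σ x y)
    (hx : x ∈ simplexBoundary σ) (hy : y ∈ simplexBoundary σ) :
    dist (f x) (f y) ≤ 5 * L * l1Dist σ x y := by
  classical
  obtain ⟨hx, i, hi, hxi⟩ := hx
  obtain ⟨hy, j, hj, hyj⟩ := hy
  have hd := l1Dist_nonneg (σ := σ) (x := x) (y := y)
  by_cases hij : i = j
  · subst hij
    have := hf i hi x hx y hy hxi hyj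
    nlinarith [mul_nonneg hL hd]
  obtain ⟨l, hl, hlij⟩ : ∃ l ∈ σ, l ∉ ({i, j} : Finset ι) := by
    apply Finset.exists_mem_notMem_of_card_lt_card
    exact lt_of_le_of_lt Finset.card_le_two hσ
  simp only [Finset.mem_insert, Finset.mem_singleton, not_or] at hlij
  -- Moving the mass at `j` to a third vertex `l` gives a point common to the facets opposite `i`
  -- and `j`. It is at distance `2 x j` from `x`, and `x j ≤ l1Dist σ x y` because `y j = 0`. The
  -- path through `z` has length at most `2 + 3` times the distance.
  set z : ι → ℝ := fun p => x p + (if p = l then x j else 0) - (if p = j then x j else 0) with hz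
  have hjl : j ≠ l := fun h => hlij.2 h.symm
  have hzj : z j = 0 := by simp [hz, hjl]
  have hzi : z i = 0 := by
    simp only [hz, hxi, if_neg hij, if_neg (fun h : i = l => hlij.1 h.symm)]; ring
  have hzmem : z ∈ simplexPoints σ := by
    refine ⟨fun p => ?_, fun p hp => ?_, ?_⟩
    · by_cases hp : p = j
      · subst hp; exact hzj.ge
      · simp only [hz, if_neg hp]
        have := hx.1 p
        have := hx.1 j
        split_ifs <;> linarith
    · have h1 : p ≠ l := fun h => hp (h ▸ hl)
      have h2 : p ≠ j := fun h => hp (h ▸ hj)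
      simp [hz, h1, h2, hx.2.1 p hp]
    · simp [hz, Finset.sum_sub_distrib, Finset.sum_add_distrib, hl, hj, hx.2.2]
  have hxj : x j ≤ l1Dist σ x y := by
    have := abs_sub_le_l1Dist (x := x) (y := y) hj
    rw [hyj, sub_zero, abs_of_nonneg (hx.1 j)] at this
    exact this
  have hxz : l1Dist σ x z ≤ 2 * l1Dist σ x y := by
    calc l1Dist σ x z ≤ ∑ p ∈ σ, ((if p = l then x j else 0) + (if p = j then x j else 0)) := by
          refine Finset.sum_le_sum fun p _ => ?_
          have := hx.1 j
          rw [hz, abs_le]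
          constructor <;> dsimp only <;> split_ifs <;> linarith
      _ = 2 * x j := by simp [Finset.sum_add_distrib, hl, hj]; ring
      _ ≤ _ := by linarith
  have hzy : l1Dist σ z y ≤ 3 * l1Dist σ x y := by
    have := l1Dist_triangle (σ := σ) (x := z) (y := x) (z := y)
    rw [l1Dist_comm (x := z) (y := x)] at this
    linarith
  have h1 := hf i hi x hx z hzmem hxi hzi
  have h2 := hf j hj z hzmem y hy hzj hyj
  have h3 := dist_triangle (f x) (f z) (f y)
  nlinarith [mul_le_mul_of_nonneg_left hxz hL, mul_le_mul_of_nonneg_left hzy hL]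

end Barycentric

/-! ### Lipschitz extension from the boundary of a simplex. -/

section Extension

variable {ι : Type u} {G : Type w} [Group G] [MetricSpace G] [IsIsometricSMul G G]

/-- The radial extension of a Lipschitz function on the boundary of a simplex to the simplex. -/
theorem exists_lipschitz_extension {K : Type*} [NormedAddCommGroup K] [NormedSpace ℝ K]
    {σ : Finset ι} {h : (ι → ℝ) → K} {L : ℝ} (hL : 0 ≤ L)
    (hb : ∀ x ∈ simplexBoundary σ, ‖h x‖ ≤ 2 * L)
    (hh : ∀ x ∈ simplexBoundary σ, ∀ y ∈ simplexBoundary σ, ‖h x - h y‖ ≤ L * l1Dist σ x y) :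
    ∃ H : (ι → ℝ) → K, (∀ x ∈ simplexBoundary σ, H x = h x) ∧
      (∀ x ∈ simplexPoints σ, ‖H x‖ ≤ 2 * L) ∧
      ∀ x ∈ simplexPoints σ, ∀ y ∈ simplexPoints σ,
        ‖H x - H y‖ ≤ L * (4 * σ.card + 1) * l1Dist σ x y := by
  have hbound : ∀ x ∈ simplexPoints σ, ∀ t : ℝ, ‖(t * radialScale σ x) • h (radial σ x)‖ ≤
      |t| * (radialScale σ x * (2 * L)) := by
    intro x hx t
    have h0 := radialScale_nonneg hx
    rw [norm_smul, Real.norm_eq_abs, abs_mul, abs_of_nonneg h0, mul_assoc]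
    refine mul_le_mul_of_nonneg_left ?_ (abs_nonneg _)
    by_cases hs : radialScale σ x = 0
    · simp [hs]
    · exact mul_le_mul_of_nonneg_left (hb _ (radial_mem_simplexBoundary hx hs)) h0
  -- The cone with value `0` at the barycentre. There `radial` divides by zero, but the vanishing
  -- factor `radialScale` makes its value irrelevant.
  refine ⟨fun x => radialScale σ x • h (radial σ x), fun x hx => ?_, fun x hx => ?_,
    fun x hx y hy => ?_⟩
  · simp only [radialScale_eq_one hx, radial_eq_self hx, one_smul]
  · have := hbound x hx 1
    rw [one_mul, abs_one, one_mul] at this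
    refine this.trans ?_
    nlinarith [radialScale_le_one hx]
  · have hsd := abs_radialScale_sub_le (σ := σ) (x := x) (y := y)
    have hd := l1Dist_nonneg (σ := σ) (x := x) (y := y)
    have hc : (0 : ℝ) ≤ σ.card := Nat.cast_nonneg _
    have key : |radialScale σ x - radialScale σ y| * (2 * L) ≤
        σ.card * l1Dist σ x y * (2 * L) := by gcongr
    have e4 : 0 ≤ L * l1Dist σ x y := mul_nonneg hL hd
    have e5 : 0 ≤ σ.card * (L * l1Dist σ x y) := mul_nonneg hc e4
    by_cases hsx : radialScale σ x = 0
    · have h1 := hbound y hy 1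
      rw [one_mul, abs_one, one_mul] at h1
      simp only [hsx, zero_smul, zero_sub, norm_neg]
      rw [hsx, zero_sub, abs_neg, abs_of_nonneg (radialScale_nonneg hy)] at key
      nlinarith
    by_cases hsy : radialScale σ y = 0
    · have h1 := hbound x hx 1
      rw [one_mul, abs_one, one_mul] at h1
      simp only [hsy, zero_smul, sub_zero]
      rw [hsy, sub_zero, abs_of_nonneg (radialScale_nonneg hx)] at key
      nlinarith
    have hRx := radial_mem_simplexBoundary hx hsx
    have hRy := radial_mem_simplexBoundary hy hsy
    -- The change of scale contributes `2 * σ.card * L` and the change of direction `(2 * σ.card +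
    -- 1) * L`.
    have e : radialScale σ x • h (radial σ x) - radialScale σ y • h (radial σ y) =
        (radialScale σ x - radialScale σ y) • h (radial σ x) +
          radialScale σ y • (h (radial σ x) - h (radial σ y)) := by
      rw [sub_smul, smul_sub]; abel
    have h1 := radialScale_mul_l1Dist_radial_le hx hy hsx hsy
    have h2 : ‖(radialScale σ x - radialScale σ y) • h (radial σ x)‖ ≤
        |radialScale σ x - radialScale σ y| * (2 * L) := by
      rw [norm_smul, Real.norm_eq_abs]
      exact mul_le_mul_of_nonneg_left (hb _ hRx) (abs_nonneg _)
    have h3 : ‖radialScale σ y • (h (radial σ x) - h (radial σ y))‖ ≤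
        L * ((2 * σ.card + 1) * l1Dist σ x y) := by
      rw [norm_smul, Real.norm_eq_abs, abs_of_nonneg (radialScale_nonneg hy)]
      calc _ ≤ radialScale σ y * (L * l1Dist σ (radial σ x) (radial σ y)) :=
            mul_le_mul_of_nonneg_left (hh _ hRx _ hRy) (radialScale_nonneg hy)
        _ = L * (radialScale σ y * l1Dist σ (radial σ x) (radial σ y)) := by ring
        _ ≤ _ := mul_le_mul_of_nonneg_left h1 hL
    beta_reduce
    rw [e]
    refine (norm_add_le _ _).trans ?_
    nlinarith

/-- The simplex has `ℓ¹`-diameter at most two, so all boundary values lie within `2L` of the value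
at one vertex. Translating that value to `1` moves them into the chart, where the cone is available.
The factor `16` is the product of the Lipschitz constants `2` and `8` of the chart maps. The cone
has norm at most `4L`, so `L ≤ 1/8` keeps it in the ball of radius `1/2`. -/
theorem HasLipschitzChartAtOne.exists_extension (hG : HasLipschitzChartAtOne G) {σ : Finset ι}
    (hσ : 2 ≤ σ.card) {f : (ι → ℝ) → G} {L : ℝ} (hL : 0 ≤ L) (hL' : L ≤ 1 / 8)
    (hf : ∀ x ∈ simplexBoundary σ, ∀ y ∈ simplexBoundary σ,
      dist (f x) (f y) ≤ L * l1Dist σ x y) :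
    ∃ F : (ι → ℝ) → G, (∀ x ∈ simplexBoundary σ, F x = f x) ∧
      ∀ x ∈ simplexPoints σ, ∀ y ∈ simplexPoints σ,
        dist (F x) (F y) ≤ 16 * (4 * σ.card + 1) * L * l1Dist σ x y := by
  classical
  obtain ⟨K, _, _, c, l, l1, hcl, hl, hc⟩ := hG
  obtain ⟨p, hp⟩ : σ.Nonempty := Finset.card_pos.1 (by omega)
  obtain ⟨q, hq, hqp⟩ := Finset.exists_mem_ne (by omega : 1 < σ.card) p
  have hy0 : (Pi.single p 1 : ι → ℝ) ∈ simplexBoundary σ := by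
    refine ⟨⟨fun r => ?_, fun r hr => ?_, ?_⟩, q, hq, by simp [hqp]⟩
    · rw [Pi.single_apply]; split_ifs <;> norm_num
    · exact Pi.single_eq_of_ne (fun h : r = p => hr (h ▸ hp)) _
    · simp [hp]
  set u0 := f (Pi.single p 1)
  have hd : ∀ x y, dist (u0⁻¹ * f x) (u0⁻¹ * f y) = dist (f x) (f y) := fun x y =>
    dist_mul_left _ _ _
  have hsmall : ∀ x ∈ simplexBoundary σ, dist (u0⁻¹ * f x) 1 ≤ 2 * L := by
    intro x hx
    have h1 := hf x hx _ hy0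
    have h2 := l1Dist_le_two hx.1 hy0.1
    rw [← hd, inv_mul_cancel] at h1
    nlinarith
  have hsmall' : ∀ x ∈ simplexBoundary σ, dist (u0⁻¹ * f x) 1 ≤ 1 / 2 := fun x hx =>
    (hsmall x hx).trans (by linarith)
  obtain ⟨H, hHb, hHn, hH⟩ := exists_lipschitz_extension (σ := σ)
    (h := fun x => l (u0⁻¹ * f x)) (L := 2 * L) (by linarith)
    (fun x hx => by
      have := hl _ 1 (hsmall' x hx) (by simp)
      rw [l1, sub_zero] at this
      have := hsmall x hx
      linarith)
    (fun x hx y hy => by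
      refine (hl _ _ (hsmall' x hx) (hsmall' y hy)).trans ?_
      rw [hd]
      have := hf x hx y hy
      linarith)
  refine ⟨fun x => u0 * c (H x), fun x hx => ?_, fun x hx y hy => ?_⟩
  · beta_reduce
    rw [hHb x hx, hcl _ (hsmall' x hx), mul_inv_cancel_left]
  · rw [dist_mul_left]
    refine (hc _ _ ((hHn x hx).trans (by linarith)) ((hHn y hy).trans (by linarith))).trans ?_
    have := hH x hx y hy
    linarith

end Extension

/-! ### Gauge transformations with Lipschitz local expressions. -/

section LipschitzGauge

variable {ι : Type u}

/-- The vertex `p` in barycentric coordinates. -/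
noncomputable def vertexPoint (p : ι) : ι → ℝ := ⇑(Finsupp.single p (1 : ℝ))

theorem vertexPoint_self (p : ι) : vertexPoint p p = 1 := by simp [vertexPoint]

theorem vertexPoint_of_ne {p q : ι} (h : q ≠ p) : vertexPoint p q = 0 := by
  simp [vertexPoint, Finsupp.single_eq_of_ne h]

theorem vertexPoint_injective : Function.Injective (vertexPoint : ι → ι → ℝ) := by
  intro p q h
  by_contra hne
  have := congrFun h p
  rw [vertexPoint_self, vertexPoint_of_ne hne] at this
  exact one_ne_zero this

theorem vertexPoint_mem {p : ι} {σ : Finset ι} (hp : p ∈ σ) : vertexPoint p ∈ simplexPoints σ := by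
  classical
  refine ⟨fun q => ?_, fun q hq => vertexPoint_of_ne fun h => hq (h ▸ hp), ?_⟩
  · by_cases h : q = p
    · rw [h, vertexPoint_self]; exact zero_le_one
    · rw [vertexPoint_of_ne h]
  · rw [Finset.sum_eq_single p (fun q _ h => vertexPoint_of_ne h) (fun h => absurd hp h),
      vertexPoint_self]

theorem eq_vertexPoint {p : ι} {x : ι → ℝ} (hx : x ∈ simplexPoints {p}) : x = vertexPoint p := by
  funext q
  by_cases h : q = p
  · rw [h, vertexPoint_self]
    simpa using hx.2.2
  · rw [vertexPoint_of_ne h]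
    exact hx.2.1 q (by simpa using h)

theorem l1Dist_vertexPoint [DecidableEq ι] {p q : ι} (h : p ≠ q) :
    l1Dist {p, q} (vertexPoint p) (vertexPoint q) = 2 := by
  rw [l1Dist, Finset.sum_pair h, vertexPoint_self, vertexPoint_self, vertexPoint_of_ne h,
    vertexPoint_of_ne h.symm]
  norm_num

theorem eq_vertexPoint_of_mem_simplexBoundary_pair [DecidableEq ι] {p q : ι} {x : ι → ℝ}
    (hx : x ∈ simplexBoundary {p, q}) : x = vertexPoint p ∨ x = vertexPoint q := by
  obtain ⟨hx, r, hr, h0⟩ := hx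
  rw [Finset.mem_insert, Finset.mem_singleton] at hr
  rcases hr with rfl | rfl
  · right
    refine eq_vertexPoint ((mem_simplexPoints_of_subset (by simp)).2 ⟨hx, fun s hs => ?_⟩)
    by_cases h : s = r
    · rw [h, h0]
    · exact hx.2.1 s (by simpa [h] using hs)
  · left
    refine eq_vertexPoint ((mem_simplexPoints_of_subset (by simp)).2 ⟨hx, fun s hs => ?_⟩)
    by_cases h : s = r
    · rw [h, h0]
    · exact hx.2.1 s (by simpa [h] using hs)

/-- The Lipschitz constants of the extension over the `n`-skeleton. -/
def gaugeConst : ℕ → ℝ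
  | 0 => 1
  | k + 1 => 16 * (4 * ((k + 2 : ℕ) : ℝ) + 1) * (5 * (gaugeConst k + 2))

theorem one_le_gaugeConst : ∀ k, 1 ≤ gaugeConst k
  | 0 => le_rfl
  | k + 1 => by
    have := one_le_gaugeConst k
    have h2 : (0 : ℝ) ≤ ((k + 2 : ℕ) : ℝ) := Nat.cast_nonneg _
    rw [gaugeConst]
    nlinarith [mul_nonneg h2 (by linarith : (0 : ℝ) ≤ 5 * (gaugeConst k + 2))]

/-- With this, `gaugeConst (k + 1) * ε ≤ 1` forces the Lipschitz constant on the boundary below the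
threshold `1/8` of the radial extension. -/
theorem mul_le_gaugeConst_succ (k : ℕ) : 16 * (5 * (gaugeConst k + 2)) ≤ gaugeConst (k + 1) := by
  have := one_le_gaugeConst k
  have h2 : (0 : ℝ) ≤ ((k + 2 : ℕ) : ℝ) := Nat.cast_nonneg _
  rw [gaugeConst]
  nlinarith [mul_nonneg h2 (by linarith : (0 : ℝ) ≤ 5 * (gaugeConst k + 2))]

variable {G : Type w} [Group G] [MetricSpace G] [IsIsometricSMul G G] [IsIsometricSMul Gᵐᵒᵖ G]

/-- A family of frames over the simplices of `Y` is `ε`-flat if the transition functions are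
`ε`-Lipschitz. -/
def IsFlatFrames (Y : Set (Finset ι)) (ε : ℝ) (φ : Finset ι → (ι → ℝ) → G) : Prop :=
  ∀ σ ∈ Y, 3 ≤ σ.card → ∀ τ, τ ⊆ σ → τ.Nonempty → ∀ x ∈ simplexPoints τ, ∀ y ∈ simplexPoints τ,
    dist ((φ τ x)⁻¹ * φ σ x) ((φ τ y)⁻¹ * φ σ y) ≤ ε * l1Dist τ x y

/-- Given two flat families of frames and a gauge transformation at the vertices which approximately
intertwines the parallel transports along the edges, there is a gauge transformation which is
Lipschitz in the given frames. -/
theorem exists_lipschitz_gauge [DecidableEq ι] (hG : HasLipschitzChartAtOne G)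
    {Y : Set (Finset ι)} (hY : ∀ σ ∈ Y, ∀ τ ⊆ σ, τ.Nonempty → τ ∈ Y)
    (hY' : ∀ σ ∈ Y, σ.Nonempty) {ε : ℝ} (hε : 0 ≤ ε) {φ φ' : Finset ι → (ι → ℝ) → G}
    (hφ : IsFlatFrames Y ε φ) (hφ' : IsFlatFrames Y ε φ') (γ₀ : ι → G)
    (hedge : ∀ p q, p ≠ q → {p, q} ∈ Y →
      dist ((φ' {p, q} (vertexPoint p))⁻¹ * γ₀ p * φ {p, q} (vertexPoint p))
        ((φ' {p, q} (vertexPoint q))⁻¹ * γ₀ q * φ {p, q} (vertexPoint q)) ≤ ε) (n : ℕ)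
    (hn : gaugeConst n * ε ≤ 1) :
    ∃ γ : (ι → ℝ) → G, (∀ p, γ (vertexPoint p) = γ₀ p) ∧
      ∀ σ ∈ Y, σ.card ≤ n + 1 → ∀ x ∈ simplexPoints σ, ∀ y ∈ simplexPoints σ,
        dist ((φ' σ x)⁻¹ * γ x * φ σ x) ((φ' σ y)⁻¹ * γ y * φ σ y) ≤
          gaugeConst n * ε * l1Dist σ x y := by
  classical
  induction n with
  | zero =>
    refine ⟨Function.extend vertexPoint γ₀ 1, fun p => vertexPoint_injective.extend_apply _ _ _,
      fun σ hσ hc x hx y hy => ?_⟩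
    obtain ⟨p, rfl⟩ := Finset.card_eq_one.1
      (le_antisymm hc (Finset.card_pos.2 (hY' σ hσ)))
    rw [eq_vertexPoint hx, eq_vertexPoint hy, dist_self]
    simp [l1Dist]
  | succ k ih =>
    have hk1 := mul_le_gaugeConst_succ k
    have hk2 := one_le_gaugeConst k
    obtain ⟨γ, hγ₀, hγ⟩ := ih (by nlinarith)
    have hLnn : 0 ≤ 5 * (gaugeConst k + 2) * ε := by positivity
    have hL8 : 5 * (gaugeConst k + 2) * ε ≤ 1 / 8 := by nlinarith
    have hext : ∀ σ : Finset ι, σ ∈ Y ∧ σ.card = k + 2 → ∃ F : (ι → ℝ) → G,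
        (∀ x ∈ simplexBoundary σ, F x = (φ' σ x)⁻¹ * γ x * φ σ x) ∧
        ∀ x ∈ simplexPoints σ, ∀ y ∈ simplexPoints σ,
          dist (F x) (F y) ≤ gaugeConst (k + 1) * ε * l1Dist σ x y := by
      rintro σ ⟨hσ, hc⟩
      have hf : ∀ x ∈ simplexBoundary σ, ∀ y ∈ simplexBoundary σ,
          dist ((φ' σ x)⁻¹ * γ x * φ σ x) ((φ' σ y)⁻¹ * γ y * φ σ y) ≤
            5 * (gaugeConst k + 2) * ε * l1Dist σ x y := by
        intro x hx y hy
        have hdn := l1Dist_nonneg (σ := σ) (x := x) (y := y)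
        -- The boundary of an edge is two points, where only `hedge` is used. Hence `IsFlatFrames`
        -- concerns only simplices with at least three vertices.
        rcases Nat.lt_or_ge σ.card 3 with h3 | h3
        · obtain ⟨p, q, hpq, rfl⟩ := Finset.card_eq_two.1 (by omega : σ.card = 2)
          have hle : ε ≤ 5 * (gaugeConst k + 2) * ε * 2 := by nlinarith
          rcases eq_vertexPoint_of_mem_simplexBoundary_pair hx with rfl | rfl <;>
            rcases eq_vertexPoint_of_mem_simplexBoundary_pair hy with rfl | rfl
          · rw [dist_self]; positivity
          · rw [l1Dist_vertexPoint hpq, hγ₀, hγ₀]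
            exact (hedge p q hpq hσ).trans hle
          · rw [dist_comm, l1Dist_comm, l1Dist_vertexPoint hpq, hγ₀, hγ₀]
            exact (hedge p q hpq hσ).trans hle
          · rw [dist_self]; positivity
        · rw [mul_assoc 5]
          refine lipschitz_simplexBoundary_of_facets (f := fun x => (φ' σ x)⁻¹ * γ x * φ σ x)
            h3 (by positivity) ?_ hx hy
          intro p hp x hx y hy hxp hyp
          have hτσ := Finset.erase_subset p σ
          have hcard : (σ.erase p).card = k + 1 := by rw [Finset.card_erase_of_mem hp]; omega
          have hτne : (σ.erase p).Nonempty := Finset.card_pos.1 (by omega)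
          have hmem : ∀ z ∈ simplexPoints σ, z p = 0 → z ∈ simplexPoints (σ.erase p) := by
            intro z hz hzp
            refine (mem_simplexPoints_of_subset hτσ).2 ⟨hz, fun q hq => ?_⟩
            by_cases hqp : q = p
            · rw [hqp, hzp]
            · exact hz.2.1 q fun hqσ => hq (Finset.mem_erase.2 ⟨hqp, hqσ⟩)
          have hx' := hmem x hx hxp
          have hy' := hmem y hy hyp
          have d1 := hφ σ hσ h3 _ hτσ hτne x hx' y hy'
          have d2 := hφ' σ hσ h3 _ hτσ hτne x hx' y hy'
          have d3 := hγ _ (hY σ hσ _ hτσ hτne) (by omega) x hx' y hy'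
          -- On a facet the expression over `σ` is the expression over the facet times two
          -- transition functions. By bi-invariance the Lipschitz constants add up, which is the `+
          -- 2` in `gaugeConst`.
          have e : ∀ z, (φ' σ z)⁻¹ * γ z * φ σ z = ((φ' (σ.erase p) z)⁻¹ * φ' σ z)⁻¹ *
              ((φ' (σ.erase p) z)⁻¹ * γ z * φ (σ.erase p) z) *
                ((φ (σ.erase p) z)⁻¹ * φ σ z) := fun z => by group
          rw [← dist_inv_inv_of_biInvariant] at d2
          rw [e x, e y]
          have hm := l1Dist_mono (x := x) (y := y) hτσ
          calc _ ≤ _ := (dist_mul_mul_le_of_biInvariant _ _ _ _).trans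
                (add_le_add (dist_mul_mul_le_of_biInvariant _ _ _ _) le_rfl)
            _ ≤ (gaugeConst k + 2) * ε * l1Dist (σ.erase p) x y := by linarith
            _ ≤ _ := by gcongr
      -- The factor `16 * (4 * (k + 2) + 1)` of the extension, applied to the boundary constant `5 *
      -- (gaugeConst k + 2) * ε`, is the recursion for `gaugeConst`.
      obtain ⟨F, hF, hF'⟩ := hG.exists_extension (σ := σ) (by omega)
        (f := fun x => (φ' σ x)⁻¹ * γ x * φ σ x) hLnn hL8 hf
      refine ⟨F, hF, fun x hx y hy => (hF' x hx y hy).trans (le_of_eq ?_)⟩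
      rw [hc, gaugeConst]
      ring
    choose! F hF hF' using hext
    have huniq : ∀ (x : ι → ℝ) (σ σ' : Finset ι), (x ∈ simplexPoints σ ∧ ∀ p ∈ σ, 0 < x p) →
        x ∈ simplexPoints σ' → σ ⊆ σ' := by
      intro x σ σ' hx hx' p hp
      by_contra h
      exact absurd (hx'.2.1 p h) (hx.2 p hp).ne'
    set P : (ι → ℝ) → Finset ι → Prop := fun x σ =>
      (σ ∈ Y ∧ σ.card = k + 2) ∧ x ∈ simplexPoints σ ∧ ∀ p ∈ σ, 0 < x p with hP
    -- By `huniq` a point is interior to at most one simplex, so the new values on different open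
    -- cells do not interfere; on the boundaries `F` reproduces the old ones.
    set γ' : (ι → ℝ) → G := fun x => if h : ∃ σ, P x σ then
      φ' h.choose x * F h.choose x * (φ h.choose x)⁻¹ else γ x with hγ'
    have hold : ∀ x σ, x ∈ simplexPoints σ → σ.card ≤ k + 1 → γ' x = γ x := by
      intro x σ hx hc
      refine dif_neg ?_
      rintro ⟨σ', ⟨-, hc'⟩, hx'⟩
      have := Finset.card_le_card (huniq x σ' σ hx' hx)
      omega
    have hnew : ∀ σ, σ ∈ Y ∧ σ.card = k + 2 → ∀ x ∈ simplexPoints σ,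
        (φ' σ x)⁻¹ * γ' x * φ σ x = F σ x := by
      intro σ hσ x hx
      by_cases hint : ∀ p ∈ σ, 0 < x p
      · have h : ∃ σ, P x σ := ⟨σ, hσ, hx, hint⟩
        have hch : h.choose = σ := Finset.Subset.antisymm
          (huniq x _ _ h.choose_spec.2 hx) (huniq x _ _ ⟨hx, hint⟩ h.choose_spec.2.1)
        have : γ' x = φ' σ x * F σ x * (φ σ x)⁻¹ := by
          rw [hγ']
          beta_reduce
          rw [dif_pos h, hch]
        rw [this]
        group
      · push Not at hint
        obtain ⟨p, hp, hxp⟩ := hint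
        have hxp0 : x p = 0 := le_antisymm hxp (hx.1 p)
        have hb : x ∈ simplexBoundary σ := ⟨hx, p, hp, hxp0⟩
        rw [hF σ hσ x hb]
        have hx' : x ∈ simplexPoints (σ.erase p) := by
          refine (mem_simplexPoints_of_subset (Finset.erase_subset p σ)).2 ⟨hx, fun q hq => ?_⟩
          by_cases hqp : q = p
          · rw [hqp, hxp0]
          · exact hx.2.1 q fun hqσ => hq (Finset.mem_erase.2 ⟨hqp, hqσ⟩)
        rw [hold x _ hx' (by rw [Finset.card_erase_of_mem hp]; omega)]
    refine ⟨γ', fun p => ?_, fun σ hσ hc x hx y hy => ?_⟩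
    · rw [hold _ {p} (vertexPoint_mem (Finset.mem_singleton_self p)) (by simp), hγ₀]
    · rcases Nat.lt_or_ge σ.card (k + 2) with hlt | hge
      · rw [hold x σ hx (by omega), hold y σ hy (by omega)]
        refine (hγ σ hσ (by omega) x hx y hy).trans ?_
        have := l1Dist_nonneg (σ := σ) (x := x) (y := y)
        have : gaugeConst k ≤ gaugeConst (k + 1) := by linarith
        gcongr
      · have hσ' : σ ∈ Y ∧ σ.card = k + 2 := ⟨hσ, by omega⟩
        rw [hnew σ hσ' x hx, hnew σ hσ' y hy]
        exact hF' σ hσ' x hx y hy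

end LipschitzGauge

/-! ### Continuity and metrics on the geometric realization. -/

theorem continuousOn_of_finite_closed_cover {α β I : Type*} [TopologicalSpace α]
    [TopologicalSpace β] [Finite I] {f : α → β} {T : Set α} {C : I → Set α}
    (hC : ∀ i, IsClosed (C i)) (hT : T ⊆ ⋃ i, C i) (hf : ∀ i, ContinuousOn f (T ∩ C i)) :
    ContinuousOn f T := by
  have e : T = ⋃ i, T ∩ C i := by rw [← Set.inter_iUnion, Set.inter_eq_left.2 hT]
  intro x hx
  rw [e, ContinuousWithinAt, nhdsWithin_iUnion, Filter.tendsto_iSup]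
  intro i
  by_cases hxi : x ∈ C i
  · exact hf i x ⟨hx, hxi⟩
  · refine continuousWithinAt_of_notMem_closure fun h => hxi ?_
    exact (hC i).closure_subset (closure_mono Set.inter_subset_right h)

namespace AbstractSimplicialComplex

namespace Realization

variable {ι : Type u} {X Y : AbstractSimplicialComplex ι}

theorem ext {x y : X.Realization} (h : ∀ p, x.1 p = y.1 p) : x = y :=
  Subtype.ext (Finsupp.ext h)

theorem coe_mem_simplexPoints {σ : Finset ι} {x : X.Realization} (hx : x ∈ face X σ) :
    ⇑x.1 ∈ simplexPoints σ := by
  refine ⟨x.2.1, fun p hp => Finsupp.notMem_support_iff.1 fun h => hp (hx h), ?_⟩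
  exact (Finsupp.sum_of_support_subset _ hx _ fun _ _ => rfl).symm.trans x.2.2.2

theorem mem_face_support (x : X.Realization) : x ∈ face X x.1.support := Finset.Subset.refl _

theorem support_mem (x : X.Realization) : x.1.support ∈ X := x.2.2.1

theorem mem_face_iff {σ : Finset ι} {x : X.Realization} :
    x ∈ face X σ ↔ ∀ p, p ∉ σ → x.1 p = 0 := by
  refine ⟨fun h => (coe_mem_simplexPoints h).2.1, fun h p hp => ?_⟩
  by_contra hpσ
  exact Finsupp.mem_support_iff.1 hp (h p hpσ)

theorem exists_of_mem_simplexPoints {σ : Finset ι} (hσ : σ ∈ X) {f : ι → ℝ}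
    (hf : f ∈ simplexPoints σ) : ∃ x : X.Realization, ⇑x.1 = f := by
  classical
  set g : ι →₀ ℝ := Finsupp.onFinset σ f fun p hp => by
    by_contra h
    exact hp (hf.2.1 p h) with hg
  have hgs : g.support ⊆ σ := Finsupp.support_onFinset_subset
  have hsum : (g.sum fun _ r => r) = 1 := by
    rw [Finsupp.sum_of_support_subset _ hgs _ fun _ _ => rfl, ← hf.2.2]
    rfl
  refine ⟨⟨g, hf.1, (X.isRelLowerSet_faces hσ).2 hgs ?_, hsum⟩, rfl⟩
  rw [Finset.nonempty_iff_ne_empty]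
  intro h
  rw [Finsupp.support_eq_empty.1 h, Finsupp.sum_zero_index] at hsum
  exact zero_ne_one hsum

theorem vertex_coe (p : ι) : ⇑(vertex X p).1 = vertexPoint p := rfl

theorem continuous_param {σ : Finset ι} (hσ : σ ∈ X) : Continuous (param X σ hσ) :=
  continuous_def.2 fun _ hU => isOpen_iff.1 hU σ hσ

theorem param_apply {σ : Finset ι} (hσ : σ ∈ X) (t : stdSimplex ℝ σ) (p : σ) :
    (param X σ hσ t).1 p = t.1 p :=
  Finsupp.embDomain_apply_self (Function.Embedding.subtype (· ∈ σ)) _ p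

theorem param_mem_face {σ : Finset ι} (hσ : σ ∈ X) (t : stdSimplex ℝ σ) :
    param X σ hσ t ∈ face X σ := by
  refine mem_face_iff.2 fun p hp => ?_
  exact Finsupp.embDomain_of_notMem_range _ _ _ (by simpa using hp)

theorem continuous_coord (p : ι) : Continuous fun x : X.Realization => x.1 p := by
  refine continuous_iSup_dom.2 fun σ => continuous_coinduced_dom.2 ?_
  by_cases hp : p ∈ σ.1
  · have : (fun x : X.Realization => x.1 p) ∘ param X σ.1 σ.2 = fun t => t.1 ⟨p, hp⟩ :=
      funext fun t => param_apply σ.2 t ⟨p, hp⟩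
    rw [this]
    exact (continuous_apply _).comp continuous_subtype_val
  · have : (fun x : X.Realization => x.1 p) ∘ param X σ.1 σ.2 = fun _ => 0 :=
      funext fun t => mem_face_iff.1 (param_mem_face σ.2 t) p hp
    rw [this]
    exact continuous_const

/-- A map into a closed simplex is continuous if its barycentric coordinates are. -/
theorem continuousOn_of_coord {Z : Type*} [TopologicalSpace Z] {f : Z → X.Realization} {S : Set Z}
    {σ : Finset ι} (hσ : σ ∈ X) (hf : Set.MapsTo f S (face X σ))
    (hc : ∀ p ∈ σ, ContinuousOn (fun z => (f z).1 p) S) : ContinuousOn f S := by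
  rw [continuousOn_iff_continuous_domRestrict]
  have hmem : ∀ z : S, (fun p : σ => (f z).1 p) ∈ stdSimplex ℝ σ := fun z => by
    have h := coe_mem_simplexPoints (hf z.2)
    refine ⟨fun p => h.1 p, ?_⟩
    exact (Finset.sum_coe_sort σ fun p => (f z).1 p).trans h.2.2
  have e : S.domRestrict f = fun z : S => param X σ hσ ⟨fun p : σ => (f z).1 p, hmem z⟩ := by
    funext z
    refine ext fun p => ?_
    by_cases hp : p ∈ σ
    · exact (param_apply hσ ⟨_, hmem z⟩ ⟨p, hp⟩).symm
    · rw [mem_face_iff.1 (param_mem_face hσ _) p hp]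
      exact mem_face_iff.1 (hf z.2) p hp
  rw [e]
  refine (continuous_param hσ).comp (Continuous.subtype_mk (continuous_pi fun p => ?_) _)
  exact continuousOn_iff_continuous_domRestrict.1 (hc p p.2)

/-- Continuity on an open subset in the weak topology can be checked on the closed simplices. -/
theorem continuousOn_of_forall_face {Z : Type*} [TopologicalSpace Z] {f : X.Realization → Z}
    {U : Set X.Realization} (hU : IsOpen U)
    (hf : ∀ σ ∈ X, ContinuousOn f (U ∩ face X σ)) : ContinuousOn f U := by
  rw [continuousOn_open_iff hU]
  intro O hO
  rw [isOpen_iff]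
  intro σ hσ
  have h1 : ContinuousOn (f ∘ param X σ hσ) (param X σ hσ ⁻¹' U) :=
    (hf σ hσ).comp (continuous_param hσ).continuousOn fun t ht => ⟨ht, param_mem_face hσ t⟩
  exact h1.isOpen_inter_preimage (hU.preimage (continuous_param hσ)) hO

theorem continuous_l1Dist (σ : Finset ι) (y : ι → ℝ) :
    Continuous fun x : X.Realization => l1Dist σ x.1 y :=
  continuous_finsetSum _ fun p _ => ((continuous_coord p).sub continuous_const).abs

theorem continuousOn_of_lipschitz {M : Type*} [PseudoMetricSpace M] {f : X.Realization → M}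
    {S : Set X.Realization} {σ : Finset ι} {C : ℝ}
    (hf : ∀ x ∈ S, ∀ y ∈ S, dist (f x) (f y) ≤ C * l1Dist σ x.1 y.1) : ContinuousOn f S := by
  intro x hx
  rw [ContinuousWithinAt, tendsto_iff_dist_tendsto_zero]
  have h1 : Filter.Tendsto (fun y : X.Realization => C * l1Dist σ y.1 x.1) (nhdsWithin x S)
      (nhds 0) := by
    have := ((continuous_l1Dist (X := X) σ x.1).const_mul C).continuousWithinAt (s := S) (x := x)
    rw [ContinuousWithinAt] at this
    simpa [l1Dist] using this
  refine squeeze_zero' (Filter.Eventually.of_forall fun _ => dist_nonneg) ?_ h1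
  filter_upwards [self_mem_nhdsWithin] with y hy using hf y hy x hx

theorem continuous_lowest (σ : Finset ι) :
    Continuous fun x : X.Realization => lowest σ x.1 := by
  rw [← continuousOn_univ]
  refine continuousOn_of_lipschitz (σ := σ) (C := 1) fun x _ y _ => ?_
  rw [Real.dist_eq, one_mul]
  exact abs_lowest_sub_le

theorem continuous_radialScale (σ : Finset ι) :
    Continuous fun x : X.Realization => radialScale σ x.1 :=
  continuous_const.sub (continuous_const.mul (continuous_lowest σ))

theorem simplexDist_nonneg {σ : Finset ι} {x y : X.Realization} : 0 ≤ simplexDist σ x y :=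
  Real.sqrt_nonneg _

theorem simplexDist_le_l1Dist (σ : Finset ι) (x y : X.Realization) :
    simplexDist σ x y ≤ l1Dist σ x.1 y.1 := by
  refine Real.sqrt_le_iff.2 ⟨l1Dist_nonneg, ?_⟩
  rw [sq, l1Dist, Finset.sum_mul]
  refine Finset.sum_le_sum fun p hp => ?_
  rw [← sq_abs, sq]
  exact mul_le_mul_of_nonneg_left (abs_sub_le_l1Dist hp) (abs_nonneg _)

/-- Each coordinate difference is at most the Euclidean distance. Returning from the `ℓ¹`-metric in
this way costs the factors `k + 1` and `n + 1` in the final constants. -/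
theorem l1Dist_le_card_mul_simplexDist (σ : Finset ι) (x y : X.Realization) :
    l1Dist σ x.1 y.1 ≤ σ.card * simplexDist σ x y := by
  rw [l1Dist, ← nsmul_eq_mul, ← Finset.sum_const]
  refine Finset.sum_le_sum fun p hp => Real.abs_le_sqrt ?_
  exact Finset.single_le_sum (f := fun p => (x.1 p - y.1 p) ^ 2) (fun _ _ => sq_nonneg _) hp

end Realization

open Realization

/-! ### The radial retraction onto the `k`-skeleton. -/

section Retraction

variable {ι : Type u} {X : AbstractSimplicialComplex ι} {k : ℕ}

theorem erase_mem_skeleton [DecidableEq ι] {σ : Finset ι} (hσ : σ ∈ X) (hc : σ.card = k + 2)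
    {p : ι} (hp : p ∈ σ) : σ.erase p ∈ X.skeleton k := by
  have h1 : (σ.erase p).card = k + 1 := by rw [Finset.card_erase_of_mem hp]; omega
  exact ⟨(X.isRelLowerSet_faces hσ).2 (Finset.erase_subset _ _) (Finset.card_pos.1 (by omega)),
    by omega⟩

theorem exists_coe_eq_radial {σ : Finset ι} (hσ : σ ∈ X) (hc : σ.card = k + 2) {f : ι → ℝ}
    (hf : f ∈ simplexBoundary σ) : ∃ x : (X.skeleton k).Realization, ⇑x.1 = f := by
  classical
  obtain ⟨hf, p, hp, h0⟩ := hf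
  refine exists_of_mem_simplexPoints (erase_mem_skeleton hσ hc hp)
    ((mem_simplexPoints_of_subset (Finset.erase_subset _ _)).2 ⟨hf, fun q hq => ?_⟩)
  by_cases h : q = p
  · rw [h, h0]
  · exact hf.2.1 q fun hqσ => hq (Finset.mem_erase.2 ⟨h, hqσ⟩)

/-- A function on the `(k + 1)`-skeleton which vanishes exactly at the barycentres of the
`(k + 1)`-simplices. -/
noncomputable def skeletonScale (x : (X.skeleton (k + 1)).Realization) : ℝ :=
  if x.1.support.card ≤ k + 1 then 1 else radialScale x.1.support x.1

theorem exists_skeletonRetraction (x : (X.skeleton (k + 1)).Realization) :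
    ∃ y : (X.skeleton k).Realization, (x.1.support.card ≤ k + 1 → ⇑y.1 = ⇑x.1) ∧
      (k + 1 < x.1.support.card → skeletonScale x ≠ 0 → ⇑y.1 = radial x.1.support x.1) := by
  have hx := x.support_mem
  by_cases hc : x.1.support.card ≤ k + 1
  · exact ⟨⟨x.1, x.2.1, ⟨hx.1, hc⟩, x.2.2.2⟩, fun _ => rfl, fun h => absurd hc (not_le.2 h)⟩
  -- At a barycentre an arbitrary vertex is chosen; such points lie outside the collar.
  by_cases hs : skeletonScale x = 0
  · obtain ⟨p, -⟩ := ((X.skeleton (k + 1)).isRelLowerSet_faces hx).1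
    exact ⟨vertex _ p, fun h => absurd h hc, fun _ h => absurd hs h⟩
  · rw [skeletonScale, if_neg hc] at hs
    obtain ⟨y, hy⟩ := exists_coe_eq_radial (k := k) hx.1
      (le_antisymm hx.2 (by omega)) (radial_mem_simplexBoundary
        (coe_mem_simplexPoints x.mem_face_support) hs)
    exact ⟨y, fun h => absurd h hc, fun _ _ => hy⟩

/-- The radial retraction from the complement of the barycentres of the `(k + 1)`-simplices to the
`k`-skeleton. -/
noncomputable def skeletonRetraction (x : (X.skeleton (k + 1)).Realization) :
    (X.skeleton k).Realization := (exists_skeletonRetraction x).choose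

theorem skeletonRetraction_of_card_le {x : (X.skeleton (k + 1)).Realization}
    (h : x.1.support.card ≤ k + 1) : ⇑(skeletonRetraction x).1 = ⇑x.1 :=
  (exists_skeletonRetraction x).choose_spec.1 h

theorem skeletonRetraction_incl (x : (X.skeleton k).Realization) :
    skeletonRetraction (incl (X.skeleton_mono (Nat.le_succ k)) x) = x :=
  Realization.ext fun p => congrFun (skeletonRetraction_of_card_le
    (x := incl (X.skeleton_mono (Nat.le_succ k)) x) x.support_mem.2) p

theorem card_le_of_mem_face {σ : Finset ι} {x : (X.skeleton (k + 1)).Realization}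
    (hx : x ∈ face _ σ) (hc : σ.card ≤ k + 1) : x.1.support.card ≤ k + 1 :=
  (Finset.card_le_card hx).trans hc

theorem mem_simplexBoundary_of_card_le {σ : Finset ι} {x : (X.skeleton (k + 1)).Realization}
    (hx : x ∈ face _ σ) (hc : σ.card = k + 2) (h : x.1.support.card ≤ k + 1) :
    ⇑x.1 ∈ simplexBoundary σ := by
  refine ⟨coe_mem_simplexPoints hx, ?_⟩
  obtain ⟨p, hp, hpx⟩ := Finset.exists_mem_notMem_of_card_lt_card
    (by omega : x.1.support.card < σ.card)
  exact ⟨p, hp, Finsupp.notMem_support_iff.1 hpx⟩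

theorem support_eq_of_card_lt {σ : Finset ι} {x : (X.skeleton (k + 1)).Realization}
    (hx : x ∈ face _ σ) (hc : σ.card = k + 2) (h : k + 1 < x.1.support.card) :
    x.1.support = σ :=
  Finset.eq_of_subset_of_card_le hx (by omega)

theorem skeletonScale_of_mem_face {σ : Finset ι} {x : (X.skeleton (k + 1)).Realization}
    (hx : x ∈ face _ σ) (hc : σ.card = k + 2) : skeletonScale x = radialScale σ x.1 := by
  rcases le_or_gt x.1.support.card (k + 1) with h | h
  · rw [skeletonScale, if_pos h, radialScale_eq_one (mem_simplexBoundary_of_card_le hx hc h)]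
  · rw [skeletonScale, if_neg (not_le.2 h), support_eq_of_card_lt hx hc h]

theorem skeletonRetraction_of_mem_face {σ : Finset ι} {x : (X.skeleton (k + 1)).Realization}
    (hx : x ∈ face _ σ) (hc : σ.card = k + 2) (hs : skeletonScale x ≠ 0) :
    ⇑(skeletonRetraction x).1 = radial σ x.1 := by
  rcases le_or_gt x.1.support.card (k + 1) with h | h
  · rw [skeletonRetraction_of_card_le h, radial_eq_self (mem_simplexBoundary_of_card_le hx hc h)]
  · refine ((exists_skeletonRetraction x).choose_spec.2 h hs).trans ?_
    rw [support_eq_of_card_lt hx hc h]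

theorem card_eq_of_mem_skeleton_succ {σ : Finset ι} (hσ : σ ∈ X.skeleton (k + 1))
    (h : ¬ σ.card ≤ k + 1) : σ.card = k + 2 := le_antisymm hσ.2 (by omega)

theorem continuous_skeletonScale :
    Continuous (skeletonScale : (X.skeleton (k + 1)).Realization → ℝ) := by
  rw [← continuousOn_univ]
  refine continuousOn_of_forall_face isOpen_univ fun σ hσ => ?_
  rw [Set.univ_inter]
  by_cases hc : σ.card ≤ k + 1
  · refine continuousOn_const.congr (f := fun _ => (1 : ℝ)) fun x hx => ?_
    rw [skeletonScale, if_pos (card_le_of_mem_face hx hc)]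
  · exact (continuous_radialScale σ).continuousOn.congr fun x hx =>
      skeletonScale_of_mem_face hx (card_eq_of_mem_skeleton_succ hσ hc)

/-- The domain of the radial retraction. -/
def skeletonCollar (X : AbstractSimplicialComplex ι) (k : ℕ) :
    Set (X.skeleton (k + 1)).Realization := {x | skeletonScale x ≠ 0}

theorem isOpen_skeletonCollar : IsOpen (skeletonCollar X k) :=
  isOpen_ne.preimage continuous_skeletonScale

theorem mem_skeletonCollar_of_card_le {x : (X.skeleton (k + 1)).Realization}
    (h : x.1.support.card ≤ k + 1) : x ∈ skeletonCollar X k := by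
  change skeletonScale x ≠ 0
  rw [skeletonScale, if_pos h]
  exact one_ne_zero

/-- The projection subtracts the lowest coordinate, so a coordinate attaining the minimum becomes
zero. The simplex is thus cut into finitely many closed pieces, each mapped into a single facet,
where continuity can be read off from coordinates. -/
theorem skeletonRetraction_mem_face [DecidableEq ι] {σ : Finset ι}
    {x : (X.skeleton (k + 1)).Realization} (hx : x ∈ face _ σ) (hc : σ.card = k + 2)
    (hs : x ∈ skeletonCollar X k) {p : ι} (hp : x.1 p = lowest σ x.1) :
    skeletonRetraction x ∈ face (X.skeleton k) (σ.erase p) := by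
  refine mem_face_iff.2 fun q hq => ?_
  rw [skeletonRetraction_of_mem_face hx hc hs]
  by_cases hqσ : q ∈ σ
  · obtain rfl : q = p := by
      by_contra h
      exact hq (Finset.mem_erase.2 ⟨h, hqσ⟩)
    rw [radial_apply hqσ, hp, sub_self, zero_div]
  · rw [radial, Set.indicator_of_notMem (by simpa using hqσ)]

theorem iUnion_eq_lowest {σ : Finset ι} (hσ : σ.Nonempty) (T : Set X.Realization) :
    T ⊆ ⋃ p : σ, {x : X.Realization | x.1 p = lowest σ x.1} := by
  intro x _
  obtain ⟨p, hp, h⟩ := exists_eq_lowest hσ x.1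
  exact Set.mem_iUnion.2 ⟨⟨p, hp⟩, h.symm⟩

theorem isClosed_eq_lowest (σ : Finset ι) (p : ι) :
    IsClosed {x : X.Realization | x.1 p = lowest σ x.1} :=
  isClosed_eq (continuous_coord p) (continuous_lowest σ)

theorem continuousOn_skeletonRetraction :
    ContinuousOn (skeletonRetraction : _ → (X.skeleton k).Realization) (skeletonCollar X k) := by
  classical
  refine continuousOn_of_forall_face isOpen_skeletonCollar fun σ hσ => ?_
  by_cases hc : σ.card ≤ k + 1
  · have hr : ∀ x ∈ skeletonCollar X k ∩ face _ σ, ⇑(skeletonRetraction x).1 = ⇑x.1 :=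
      fun x hx => skeletonRetraction_of_card_le (card_le_of_mem_face hx.2 hc)
    refine continuousOn_of_coord (σ := σ) ⟨hσ.1, hc⟩ (fun x hx => ?_) fun p _ => ?_
    · refine mem_face_iff.2 fun p hp => ?_
      rw [hr x hx]
      exact mem_face_iff.1 hx.2 p hp
    · exact (continuous_coord p).continuousOn.congr fun x hx => by rw [hr x hx]
  · have hc := card_eq_of_mem_skeleton_succ hσ hc
    refine continuousOn_of_finite_closed_cover (fun p : σ => isClosed_eq_lowest σ p)
      (iUnion_eq_lowest (Finset.card_pos.1 (by omega)) _) fun p => ?_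
    refine continuousOn_of_coord (erase_mem_skeleton hσ.1 hc p.2)
      (fun x hx => skeletonRetraction_mem_face hx.1.2 hc hx.1.1 hx.2) fun q hq => ?_
    have : ContinuousOn (fun x : (X.skeleton (k + 1)).Realization =>
        (x.1 q - lowest σ x.1) / radialScale σ x.1)
        ((skeletonCollar X k ∩ face _ σ) ∩ {x | x.1 p = lowest σ x.1}) := by
      refine ContinuousOn.div ?_ ?_ fun x hx => ?_
      · exact ((continuous_coord q).sub (continuous_lowest σ)).continuousOn
      · exact (continuous_radialScale σ).continuousOn
      · rw [← skeletonScale_of_mem_face hx.1.2 hc]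
        exact hx.1.1
    refine this.congr fun x hx => ?_
    rw [skeletonRetraction_of_mem_face hx.1.2 hc hx.1.1, radial_apply (Finset.mem_of_mem_erase hq)]

/-- The composition with the radial retraction of a function which is continuous on the facets of a
simplex is continuous. -/
theorem continuousOn_comp_skeletonRetraction [DecidableEq ι] {Z : Type*} [TopologicalSpace Z]
    {σ : Finset ι} (hc : σ.card = k + 2) {O : Set (X.skeleton k).Realization}
    {g : (X.skeleton k).Realization → Z}
    (hg : ∀ p ∈ σ, ContinuousOn g (O ∩ face _ (σ.erase p))) :
    ContinuousOn (fun x => g (skeletonRetraction x))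
      ((skeletonCollar X k ∩ skeletonRetraction ⁻¹' O) ∩ face _ σ) := by
  refine continuousOn_of_finite_closed_cover (fun p : σ => isClosed_eq_lowest σ p)
    (iUnion_eq_lowest (Finset.card_pos.1 (by omega)) _) fun p => ?_
  exact (hg p p.2).comp (continuousOn_skeletonRetraction.mono fun x hx => hx.1.1.1)
    fun x hx => ⟨hx.1.1.2, skeletonRetraction_mem_face hx.1.2 hc hx.1.1.1 hx.2⟩

/-- The open `(k + 1)`-simplices are open in the `(k + 1)`-skeleton. -/
theorem isOpen_support_eq {σ : Finset ι} (hc : σ.card = k + 2) :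
    IsOpen {x : (X.skeleton (k + 1)).Realization | x.1.support = σ} := by
  have : {x : (X.skeleton (k + 1)).Realization | x.1.support = σ} =
      ⋂ p ∈ σ, {x | x.1 p ≠ 0} := by
    ext x
    simp only [Set.mem_iInter]
    constructor
    · rintro rfl p hp
      exact Finsupp.mem_support_iff.1 hp
    · intro h
      -- In the `(k + 1)`-skeleton no support has more than `k + 2` vertices, so containing `σ`
      -- means being equal to it.
      refine (Finset.eq_of_subset_of_card_le (fun p hp => Finsupp.mem_support_iff.2 (h p hp)) ?_).symm
      have := x.support_mem.2
      omega
  rw [this]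
  exact isOpen_biInter_finset fun p _ => isOpen_ne.preimage (continuous_coord p)

end Retraction

end AbstractSimplicialComplex

/-! ### Charts of Hilbert module bundles and bundles built from frames. -/

namespace HilbertModuleBundle

variable {A : Type v} [NonUnitalCStarAlgebra A] [PartialOrder A] [StarOrderedRing A]
  {V : Type w} [NormedAddCommGroup V] [NormedSpace ℂ V] [SMul A V] [CStarModule A V]

section Charts

variable {B : Type u} [TopologicalSpace B] (E : HilbertModuleBundle A V B)
  (e e' : Bundle.Trivialization V (Bundle.TotalSpace.proj : Bundle.TotalSpace V E.Fiber → B))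
  [MemTrivializationAtlas e] [MemTrivializationAtlas e']

/-- The fibrewise isomorphism given by a chart. -/
noncomputable def chartIso (x : B) (hx : x ∈ e.baseSet) : HilbertModuleIso A (E.Fiber x) V where
  toLinearEquiv := e.linearEquivAt ℂ x hx
  inner_map' := E.inner_chart e x hx

theorem toCLM_chartIso {x : B} (hx : x ∈ e.baseSet) :
    (E.chartIso e x hx).toCLM = e.continuousLinearMapAt ℂ x := by
  ext v
  exact (congrFun (e.coe_linearMapAt_of_mem (R := ℂ) hx) v).symm

theorem toCLM_symm_chartIso {x : B} (hx : x ∈ e.baseSet) :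
    (E.chartIso e x hx).symm.toCLM = e.symmL ℂ x := by
  ext v
  exact (e.symmL_apply hx v).symm

open Classical in
/-- The expression of a frame of the fibre over `x` in a chart. -/
noncomputable def inChart {x : B} (f : HilbertModuleIso A V (E.Fiber x)) :
    HilbertModuleIso A V V :=
  if hx : x ∈ e.baseSet then f.trans (E.chartIso e x hx) else 1

theorem inChart_of_mem {x : B} (hx : x ∈ e.baseSet) (f : HilbertModuleIso A V (E.Fiber x)) :
    E.inChart e f = f.trans (E.chartIso e x hx) := dif_pos hx

theorem inChart_trans {x : B} (hx : x ∈ e.baseSet) (g : HilbertModuleIso A V V)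
    (f : HilbertModuleIso A V (E.Fiber x)) : E.inChart e (g.trans f) = E.inChart e f * g := by
  rw [inChart_of_mem E e hx, inChart_of_mem E e hx]
  rfl

/-- The frame `s` cancels and the coordinate change of the bundle remains, so `s` may be
discontinuous. -/
theorem continuousOn_inChart_coordChange (s : ∀ x, HilbertModuleIso A V (E.Fiber x)) :
    ContinuousOn (fun x => E.inChart e' (s x) * (E.inChart e (s x))⁻¹)
      (e.baseSet ∩ e'.baseSet) := by
  rw [HilbertModuleIso.isometry_toCLM.isEmbedding.isInducing.continuousOn_iff]
  refine (continuousOn_coordChange ℂ e e').congr fun x hx => ?_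
  ext v
  rw [Function.comp_apply, inChart_of_mem E e hx.1, inChart_of_mem E e' hx.2]
  refine Eq.trans ?_ (e.coordChangeL_apply (R := ℂ) e' hx v).symm
  change E.chartIso e' x hx.2 (s x ((s x).symm ((E.chartIso e x hx.1).symm v))) = _
  rw [HilbertModuleIso.apply_symm_apply]
  rfl

theorem TrivializationOn.continuousOn_inChart {S : Set B} (Φ : E.TrivializationOn S) :
    ContinuousOn (fun x : S => E.inChart e (Φ.iso x)) {x : S | (x : B) ∈ e.baseSet} := by
  rw [HilbertModuleIso.isometry_toCLM.isEmbedding.isInducing.continuousOn_iff]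
  refine (Φ.continuousOn_iso e).congr fun x hx => ?_
  rw [Function.comp_apply, inChart_of_mem E e hx, HilbertModuleIso.toCLM_trans, toCLM_chartIso]

end Charts

section Construction

variable {B : Type u} [TopologicalSpace B] {I : Type*}

/-- The vector bundle core with coordinate changes `c_j⁻¹ c_i`. -/
noncomputable def coreOfFrames (U : I → Set B) (hU : ∀ i, IsOpen (U i)) (hcov : ∀ x, ∃ i, x ∈ U i)
    (c : I → B → HilbertModuleIso A V V)
    (hc : ∀ i j, ContinuousOn (fun x => (c j x)⁻¹ * c i x) (U i ∩ U j)) :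
    VectorBundleCore ℂ B V I where
  baseSet := U
  isOpen_baseSet := hU
  indexAt x := (hcov x).choose
  mem_baseSet_at x := (hcov x).choose_spec
  coordChange i j x := ((c j x)⁻¹ * c i x).toCLM
  coordChange_self i x _ v := by rw [inv_mul_cancel]; rfl
  continuousOn_coordChange i j :=
    HilbertModuleIso.isometry_toCLM.continuous.comp_continuousOn (hc i j)
  coordChange_comp i j k x _ v := by
    have : (c k x)⁻¹ * c i x = (c k x)⁻¹ * c j x * ((c j x)⁻¹ * c i x) := by group
    rw [this]
    rfl

/-- The Hilbert module bundle with coordinate changes `c_j⁻¹ c_i`. -/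
noncomputable def ofFrames (U : I → Set B) (hU : ∀ i, IsOpen (U i)) (hcov : ∀ x, ∃ i, x ∈ U i)
    (c : I → B → HilbertModuleIso A V V)
    (hc : ∀ i j, ContinuousOn (fun x => (c j x)⁻¹ * c i x) (U i ∩ U j)) :
    HilbertModuleBundle A V B :=
  let Z := coreOfFrames U hU hcov c hc
  { Fiber := fun _ => V
    totalSpaceTopology := Z.toTopologicalSpace
    fiberBundle := Z.fiberBundle
    vectorBundle := Z.vectorBundle
    inner_chart := by
      rintro e ⟨i, rfl⟩ x _ v w
      exact ((c i x)⁻¹ * c (hcov x).choose x).inner_map v w }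

/-- The `c_j⁻¹ c_i` satisfy the cocycle identity automatically, being quotients of functions that
need not be continuous themselves. The reference frame `s` is chosen so that `(c i x)⁻¹ * b x` is
the expression of the frame `b` in the chart `i`. -/
theorem exists_bundle_of_frames (U : I → Set B) (hU : ∀ i, IsOpen (U i))
    (hcov : ∀ x, ∃ i, x ∈ U i) (c : I → B → HilbertModuleIso A V V)
    (hc : ∀ i j, ContinuousOn (fun x => (c j x)⁻¹ * c i x) (U i ∩ U j)) :
    ∃ (E : HilbertModuleBundle A V B) (s : ∀ x, HilbertModuleIso A V (E.Fiber x)),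
      ∀ (S : Set B) (b : B → HilbertModuleIso A V V),
        (∀ i, ContinuousOn (fun x => (c i x)⁻¹ * b x) (U i ∩ S)) →
        ∃ Φ : E.TrivializationOn S, ∀ x, Φ.iso x = (b x).trans (s x) := by
  let s : ∀ _ : B, HilbertModuleIso A V V := fun x => (c (hcov x).choose x)⁻¹
  refine ⟨ofFrames U hU hcov c hc, s, fun S b hb =>
    ⟨⟨fun x => (b x).trans (s x), ?_⟩, fun x => rfl⟩⟩
  rintro e ⟨i, rfl⟩
  have h1 : ContinuousOn (fun x : S => (c i x)⁻¹ * b x) {x : S | (x : B) ∈ U i} :=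
    (hb i).comp continuous_subtype_val.continuousOn fun x hx => ⟨hx, x.2⟩
  refine (HilbertModuleIso.isometry_toCLM.continuous.comp_continuousOn h1).congr fun x hx => ?_
  ext v
  refine ((coreOfFrames U hU hcov c hc).localTriv i).continuousLinearMapAt_apply_of_mem (R := ℂ)
    hx _ |>.trans ?_
  have h2 : (c i x)⁻¹ * b x = (c i x)⁻¹ * c (hcov x).choose x * (s x * b x) := by
    simp only [s]
    group
  change ((c i x)⁻¹ * c (hcov x).choose x * (s x * b x)) v = ((c i x)⁻¹ * b x) v
  rw [h2]

end Construction

end HilbertModuleBundle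

/-! ### Trivializations as group-valued functions. -/

namespace HilbertModuleBundle

open AbstractSimplicialComplex Realization

variable {A : Type v} [NonUnitalCStarAlgebra A] [PartialOrder A] [StarOrderedRing A]
  {V : Type w} [NormedAddCommGroup V] [NormedSpace ℂ V] [SMul A V] [CStarModule A V]
  {ι : Type u} {X Y : AbstractSimplicialComplex ι}

/-- A fibrewise isomorphism whose local expressions over the simplices are continuous is an
isomorphism of bundles. -/
def isoOverOfFaces {E : HilbertModuleBundle A V X.Realization}
    {E' : HilbertModuleBundle A V Y.Realization} {f : X.Realization → Y.Realization}
    (hf : Continuous f) (iso : ∀ x, HilbertModuleIso A (E.Fiber x) (E'.Fiber (f x)))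
    (H : ∀ σ ∈ X, ∃ (Φ : E.TrivializationOn (face X σ)) (S : Set Y.Realization)
      (Φ' : E'.TrivializationOn S) (hS : ∀ x : face X σ, f x ∈ S),
      Continuous fun x : face X σ =>
        ((Φ.iso x).trans (iso x)).trans (Φ'.iso ⟨f x, hS x⟩).symm) :
    IsoOver f E E' where
  iso := iso
  continuousOn_iso e e' _ _ := by
    refine continuousOn_of_forall_face (e.open_baseSet.inter (e'.open_baseSet.preimage hf))
      fun σ hσ => ?_
    obtain ⟨Φ, S, Φ', hS, hloc⟩ := H σ hσ
    rw [Set.inter_comm, ← Subtype.image_preimage_coe,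
      Topology.IsInducing.subtypeVal.continuousOn_image_iff]
    have h1 := (TrivializationOn.continuousOn_inChart E e Φ).mono
      (fun x (hx : (x : X.Realization) ∈ e.baseSet ∩ f ⁻¹' e'.baseSet) => hx.1)
    have h2 := (TrivializationOn.continuousOn_inChart E' e' Φ').comp
      ((hf.comp continuous_subtype_val).subtype_mk hS).continuousOn
      (fun x (hx : (x : X.Realization) ∈ e.baseSet ∩ f ⁻¹' e'.baseSet) => hx.2)
    -- In charts the isomorphism is its local expression, multiplied by the chart expressions of
    -- `Φ'` and of the inverse of `Φ`.
    refine (HilbertModuleIso.isometry_toCLM.continuous.comp_continuousOn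
      ((h2.mul hloc.continuousOn).mul h1.inv)).congr fun x hx => ?_
    simp only [Function.comp_apply, Pi.mul_apply, Pi.inv_apply]
    rw [inChart_of_mem E e hx.1, inChart_of_mem E' e' hx.2, ← toCLM_chartIso E' e' hx.2,
      ← toCLM_symm_chartIso E e hx.1]
    ext v
    change E'.chartIso e' _ hx.2 (iso x ((E.chartIso e _ hx.1).symm v)) =
      E'.chartIso e' _ hx.2 (Φ'.iso ⟨f x, hS x⟩ ((Φ'.iso ⟨f x, hS x⟩).symm (iso x (Φ.iso x ((Φ.iso x).symm
        ((E.chartIso e _ hx.1).symm v))))))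
    rw [HilbertModuleIso.apply_symm_apply, HilbertModuleIso.apply_symm_apply]

section Frames

variable {E : HilbertModuleBundle A V X.Realization} (Φ : E.TrivializationFamily)

/-- The value at `x` of the trivialization over the simplex whose interior contains `x`. -/
def supportFrame (x : X.Realization) : HilbertModuleIso A V (E.Fiber x) :=
  (Φ ⟨x.1.support, x.support_mem⟩).iso ⟨x, x.mem_face_support⟩

open Classical in
/-- The trivialization over `σ` relative to the one over the simplex whose interior contains `x`. -/
noncomputable def frame (σ : Finset ι) (x : X.Realization) : HilbertModuleIso A V V :=
  if h : σ ∈ X ∧ x ∈ face X σ then ((Φ ⟨σ, h.1⟩).iso ⟨x, h.2⟩).trans (supportFrame Φ x).symm else 1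

theorem frame_of_mem {σ : Finset ι} (hσ : σ ∈ X) {x : X.Realization} (hx : x ∈ face X σ) :
    frame Φ σ x = ((Φ ⟨σ, hσ⟩).iso ⟨x, hx⟩).trans (supportFrame Φ x).symm :=
  dif_pos ⟨hσ, hx⟩

theorem frame_trans {σ : Finset ι} (hσ : σ ∈ X) {x : X.Realization} (hx : x ∈ face X σ) :
    (frame Φ σ x).trans (supportFrame Φ x) = (Φ ⟨σ, hσ⟩).iso ⟨x, hx⟩ := by
  rw [frame_of_mem Φ hσ hx]
  ext v
  simp

theorem transition_eq (ρ σ : {σ : Finset ι // σ ∈ X}) (h : ρ.1 ⊆ σ.1) (x : face X ρ.1) :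
    transition Φ ρ σ h x = (frame Φ ρ.1 x)⁻¹ * frame Φ σ.1 x := by
  rw [transition, ← frame_trans Φ ρ.2 x.2, ← frame_trans Φ σ.2 (face_mono h x.2)]
  ext v
  change (frame Φ ρ.1 x.1).symm ((supportFrame Φ x.1).symm (supportFrame Φ x.1
    (frame Φ σ.1 x.1 v))) = (frame Φ ρ.1 x.1).symm (frame Φ σ.1 x.1 v)
  rw [HilbertModuleIso.symm_apply_apply]

theorem inChart_supportFrame_mul_frame (e : Bundle.Trivialization V
    (Bundle.TotalSpace.proj : Bundle.TotalSpace V E.Fiber → X.Realization))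
    [MemTrivializationAtlas e] {σ : Finset ι} (hσ : σ ∈ X) {x : X.Realization}
    (hx : x ∈ face X σ) (he : x ∈ e.baseSet) :
    E.inChart e (supportFrame Φ x) * frame Φ σ x = E.inChart e ((Φ ⟨σ, hσ⟩).iso ⟨x, hx⟩) := by
  rw [← frame_trans Φ hσ hx, inChart_trans E e he]

/-- Neither factor need be continuous across cells, but the jumps cancel: the product is the chart
expression of `Φ_σ`. -/
theorem continuousOn_inChart_supportFrame_mul_frame (e : Bundle.Trivialization V
    (Bundle.TotalSpace.proj : Bundle.TotalSpace V E.Fiber → X.Realization))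
    [MemTrivializationAtlas e] {σ : Finset ι} (hσ : σ ∈ X) :
    ContinuousOn (fun x => E.inChart e (supportFrame Φ x) * frame Φ σ x)
      (e.baseSet ∩ face X σ) := by
  rw [Set.inter_comm, ← Subtype.image_preimage_coe,
    Topology.IsInducing.subtypeVal.continuousOn_image_iff]
  exact (TrivializationOn.continuousOn_inChart E e (Φ ⟨σ, hσ⟩)).congr fun x hx =>
    inChart_supportFrame_mul_frame Φ e hσ x.2 hx

end Frames

/-! ### Gluing in the `(k + 1)`-simplices. -/

section Extension

variable {k : ℕ} {E : HilbertModuleBundle A V (X.skeleton k).Realization}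
  (Φ : E.TrivializationFamily)
  (β : Finset ι → (X.skeleton k).Realization → HilbertModuleIso A V V)

/-- The fibres of the extended bundle over the open `(k + 1)`-simplices `σ` are compared with those
of `E` by means of the trivialization `β σ` over the boundary of `σ`. -/
noncomputable def collarFrame (x : (X.skeleton (k + 1)).Realization) : HilbertModuleIso A V V :=
  if x.1.support.card ≤ k + 1 then 1 else β x.1.support (skeletonRetraction x)

/-- The frames of the extended bundle. -/
noncomputable def extendedFrame (τ : Finset ι) (x : (X.skeleton (k + 1)).Realization) :
    HilbertModuleIso A V V :=
  if τ.card ≤ k + 1 then frame Φ τ (skeletonRetraction x)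
  else if x.1.support.card ≤ k + 1 then β τ (skeletonRetraction x) else 1

-- The jumps of both factors at the boundary of `τ` compensate, which makes the new trivialization
-- continuous up to the boundary.
variable {β} in
theorem collarFrame_mul_extendedFrame {τ : Finset ι} (hc : τ.card = k + 2)
    {x : (X.skeleton (k + 1)).Realization} (hx : x ∈ face _ τ) :
    collarFrame β x * extendedFrame Φ β τ x = β τ (skeletonRetraction x) := by
  rw [extendedFrame, if_neg (by omega), collarFrame]
  split_ifs with h
  · rw [one_mul]
  · rw [support_eq_of_card_lt hx hc (not_le.1 h), mul_one]

theorem exists_extension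
    (hβ : ∀ σ ∈ X, σ.card = k + 2 → ∀ (τ : Finset ι), τ ∈ X.skeleton k → τ ⊆ σ →
      ContinuousOn (fun y => (frame Φ τ y)⁻¹ * β σ y) (face _ τ)) :
    ∃ (E' : HilbertModuleBundle A V (X.skeleton (k + 1)).Realization)
      (Φ' : E'.TrivializationFamily),
      IsExtension (X.skeleton_mono (Nat.le_succ k)) E Φ E' Φ' ∧
      ∀ (ρ σ : {σ : Finset ι // σ ∈ X.skeleton (k + 1)}) (h : ρ.1 ⊆ σ.1) (x : face _ ρ.1),
        transition Φ' ρ σ h x = (extendedFrame Φ β ρ.1 x)⁻¹ * extendedFrame Φ β σ.1 x := by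
  classical
  -- Two kinds of charts: those of `E` pulled back to the collar along the retraction, and the open
  -- `(k + 1)`-simplices with constant frame.
  let I := {e : Bundle.Trivialization V
    (Bundle.TotalSpace.proj : Bundle.TotalSpace V E.Fiber → (X.skeleton k).Realization) //
      MemTrivializationAtlas e} ⊕ {σ : Finset ι // σ ∈ X ∧ σ.card = k + 2}
  let U : I → Set (X.skeleton (k + 1)).Realization := Sum.elim
    (fun e => skeletonCollar X k ∩ skeletonRetraction ⁻¹' e.1.baseSet)
    (fun σ => {x | x.1.support = σ.1})
  -- On the collar, `(c i x)⁻¹` first passes from the reference frame at `x` to `supportFrame` at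
  -- its retraction, by the clutching map `collarFrame`, and then to the chart of `E`.
  let c : I → (X.skeleton (k + 1)).Realization → HilbertModuleIso A V V := Sum.elim
    (fun e x => haveI := e.2
      (E.inChart e.1 (supportFrame Φ (skeletonRetraction x)) * collarFrame β x)⁻¹)
    (fun _ _ => 1)
  have hU : ∀ i, IsOpen (U i) := by
    rintro (e | σ)
    · exact continuousOn_skeletonRetraction.isOpen_inter_preimage isOpen_skeletonCollar
        e.1.open_baseSet
    · exact isOpen_support_eq σ.2.2
  have hcov : ∀ x, ∃ i, x ∈ U i := by
    intro x
    by_cases h : x.1.support.card ≤ k + 1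
    · exact ⟨Sum.inl ⟨trivializationAt V E.Fiber (skeletonRetraction x), inferInstance⟩,
        mem_skeletonCollar_of_card_le h, FiberBundle.mem_baseSet_trivializationAt' _⟩
    · exact ⟨Sum.inr ⟨x.1.support, x.support_mem.1,
        card_eq_of_mem_skeleton_succ x.support_mem h⟩, rfl⟩
  have hg : ∀ (e : Bundle.Trivialization V
      (Bundle.TotalSpace.proj : Bundle.TotalSpace V E.Fiber → (X.skeleton k).Realization))
      [MemTrivializationAtlas e] (σ : Finset ι), σ ∈ X → σ.card = k + 2 →
      ContinuousOn (fun x => E.inChart e (supportFrame Φ (skeletonRetraction x)) *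
        β σ (skeletonRetraction x))
        ((skeletonCollar X k ∩ skeletonRetraction ⁻¹' e.baseSet) ∩ face _ σ) := by
    intro e _ σ hσ hc
    -- On each facet `τ` insert `frame Φ τ`: both the chart expression of `Φ_τ` and `(frame Φ τ)⁻¹ *
    -- β σ` are continuous there.
    refine continuousOn_comp_skeletonRetraction
      (g := fun y => E.inChart e (supportFrame Φ y) * β σ y) hc fun p hp => ?_
    have hτ := erase_mem_skeleton hσ hc hp
    refine ((continuousOn_inChart_supportFrame_mul_frame Φ e hτ).mul
      ((hβ σ hσ hc _ hτ (Finset.erase_subset _ _)).mono Set.inter_subset_right)).congr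
        fun y _ => ?_
    simp only [Pi.mul_apply]
    group
  have hmix : ∀ (e : Bundle.Trivialization V
      (Bundle.TotalSpace.proj : Bundle.TotalSpace V E.Fiber → (X.skeleton k).Realization))
      [MemTrivializationAtlas e] (σ : Finset ι), σ ∈ X → σ.card = k + 2 →
      ContinuousOn (fun x => E.inChart e (supportFrame Φ (skeletonRetraction x)) *
        collarFrame β x)
        ((skeletonCollar X k ∩ skeletonRetraction ⁻¹' e.baseSet) ∩ {x | x.1.support = σ}) := by
    intro e _ σ hσ hc
    refine ((hg e σ hσ hc).mono fun x hx => ⟨hx.1, ?_⟩).congr fun x hx => ?_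
    · have : x.1.support = σ := hx.2
      exact this ▸ x.mem_face_support
    · have : x.1.support = σ := hx.2
      rw [collarFrame, this, if_neg (by omega)]
  have hc : ∀ i j, ContinuousOn (fun x => (c j x)⁻¹ * c i x) (U i ∩ U j) := by
    rintro (⟨e, he⟩ | σ) (⟨e', he'⟩ | σ')
    · refine ((continuousOn_inChart_coordChange E e e' (supportFrame Φ)).comp
        (continuousOn_skeletonRetraction.mono fun x hx => hx.1.1)
        fun x hx => ⟨hx.1.2, hx.2.2⟩).congr fun x _ => ?_
      simp only [c, Sum.elim_inl, Function.comp_apply]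
      group
    · refine (hmix e σ'.1 σ'.2.1 σ'.2.2).inv.congr fun x _ => ?_
      simp only [c, Sum.elim_inl, Sum.elim_inr, Pi.inv_apply, inv_one, one_mul]
    · refine ((hmix e' σ.1 σ.2.1 σ.2.2).mono fun x hx => ⟨hx.2, hx.1⟩).congr fun x _ => ?_
      simp only [c, Sum.elim_inl, Sum.elim_inr, inv_inv, mul_one]
    · exact continuousOn_const (c := (1 : HilbertModuleIso A V V)⁻¹ * 1)
  obtain ⟨E', s, hE'⟩ := exists_bundle_of_frames U hU hcov c hc
  have hframe : ∀ τ : {τ : Finset ι // τ ∈ X.skeleton (k + 1)},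
      ∃ Ψ : E'.TrivializationOn (face _ τ.1), ∀ x,
        Ψ.iso x = (extendedFrame Φ β τ.1 x).trans (s x) := by
    rintro ⟨τ, hτ⟩
    refine hE' _ (extendedFrame Φ β τ) ?_
    rintro (⟨e, he⟩ | σ)
    · by_cases hτc : τ.card ≤ k + 1
      · have hτk : τ ∈ X.skeleton k := ⟨hτ.1, hτc⟩
        refine ((continuousOn_inChart_supportFrame_mul_frame Φ e hτk).comp
          (continuousOn_skeletonRetraction.mono fun x hx => hx.1.1)
          fun x hx => ⟨hx.1.2, ?_⟩).congr fun x hx => ?_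
        · refine mem_face_iff.2 fun p hp => ?_
          rw [skeletonRetraction_of_card_le (card_le_of_mem_face hx.2 hτc)]
          exact mem_face_iff.1 hx.2 p hp
        · simp only [c, Sum.elim_inl, Function.comp_apply]
          rw [collarFrame, if_pos (card_le_of_mem_face hx.2 hτc), extendedFrame, if_pos hτc,
            mul_one, inv_inv]
      · have hτc' := card_eq_of_mem_skeleton_succ hτ hτc
        refine (hg e τ hτ.1 hτc').congr fun x hx => ?_
        simp only [c, Sum.elim_inl]
        rw [← collarFrame_mul_extendedFrame (β := β) Φ hτc' hx.2, inv_inv, mul_assoc]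
    · refine continuousOn_const.congr (f := fun _ => (1 : HilbertModuleIso A V V)) fun x hx => ?_
      have hxσ : x.1.support = σ.1 := hx.1
      have hσ := σ.2.2
      have h1 : σ.1 ⊆ τ := hxσ ▸ hx.2
      have h2 := Finset.card_le_card h1
      simp only [c, Sum.elim_inr, inv_one, one_mul]
      rw [extendedFrame, if_neg (by omega), hxσ, if_neg (by omega)]
  choose Φ' hΦ' using hframe
  have hXY := X.skeleton_mono (Nat.le_succ k)
  have hθ : ∀ (σ : {σ : Finset ι // σ ∈ X.skeleton k}) (x : face _ σ.1),
      ((Φ σ).iso x).trans ((supportFrame Φ x.1).symm.trans (s (incl hXY x.1))) =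
        (Φ' ⟨σ.1, hXY σ.2⟩).iso ⟨incl hXY x.1, x.2⟩ := by
    intro σ x
    rw [hΦ', extendedFrame, if_pos σ.2.2, skeletonRetraction_incl, frame_of_mem Φ σ.2 x.2]
    rfl
  refine ⟨E', Φ', ⟨isoOverOfFaces (continuous_incl hXY)
    (fun x => (supportFrame Φ x).symm.trans (s (incl hXY x))) fun σ hσ =>
      ⟨Φ ⟨σ, hσ⟩, _, Φ' ⟨σ, hXY hσ⟩, fun x => x.2, ?_⟩, ?_⟩, ?_⟩
  · refine continuous_const.congr (f := fun _ => (1 : HilbertModuleIso A V V)) fun x => ?_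
    rw [hθ ⟨σ, hσ⟩ x]
    ext v
    simp
  · intro σ x v
    rw [← hθ σ x]
    rfl
  · intro ρ σ h x
    ext v
    change ((Φ' ρ).iso x).symm ((Φ' σ).iso ⟨x.1, face_mono h x.2⟩ v) = _
    rw [hΦ', hΦ']
    change (extendedFrame Φ β ρ.1 x).symm ((s x).symm (s x (extendedFrame Φ β σ.1 x v))) =
      (extendedFrame Φ β ρ.1 x).symm (extendedFrame Φ β σ.1 x v)
    rw [HilbertModuleIso.symm_apply_apply]

end Extension

end HilbertModuleBundle

/-! ### Flatness, transport and holonomy in barycentric coordinates. -/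

namespace HilbertModuleBundle

open AbstractSimplicialComplex Realization

variable {A : Type v} [NonUnitalCStarAlgebra A] [PartialOrder A] [StarOrderedRing A]
  {V : Type w} [NormedAddCommGroup V] [NormedSpace ℂ V] [SMul A V] [CStarModule A V]
  {ι : Type u} {X : AbstractSimplicialComplex ι}

section BarycentricFrames

variable {E : HilbertModuleBundle A V X.Realization} (Φ : E.TrivializationFamily)

/-- The frame over `σ` as a function of the barycentric coordinates. -/
noncomputable def barycentricFrame (σ : Finset ι) : (ι → ℝ) → HilbertModuleIso A V V :=
  Function.extend (fun x : X.Realization => (⇑x.1 : ι → ℝ)) (frame Φ σ) 1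

theorem barycentricFrame_coe (σ : Finset ι) (x : X.Realization) :
    barycentricFrame Φ σ x.1 = frame Φ σ x :=
  Function.Injective.extend_apply
    (fun _ _ h => Realization.ext fun p => congrFun h p) _ _ x

theorem exists_mem_face {σ : Finset ι} (hσ : σ ∈ X) {x : ι → ℝ} (hx : x ∈ simplexPoints σ) :
    ∃ y ∈ face X σ, (⇑y.1 : ι → ℝ) = x := by
  obtain ⟨y, rfl⟩ := exists_of_mem_simplexPoints hσ hx
  exact ⟨y, mem_face_iff.2 hx.2.1, rfl⟩

variable {Φ} in
theorem IsFlatFamily.dist_le {ε : ℝ} (hΦ : IsFlatFamily ε Φ) (hε : 0 ≤ ε) {ρ σ : Finset ι}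
    (hρ : ρ ∈ X) (hσ : σ ∈ X) (h : ρ ⊆ σ) {x y : ι → ℝ} (hx : x ∈ simplexPoints ρ)
    (hy : y ∈ simplexPoints ρ) :
    dist ((barycentricFrame Φ ρ x)⁻¹ * barycentricFrame Φ σ x)
      ((barycentricFrame Φ ρ y)⁻¹ * barycentricFrame Φ σ y) ≤ ε * l1Dist ρ x y := by
  obtain ⟨x, hx', rfl⟩ := exists_mem_face hρ hx
  obtain ⟨y, hy', rfl⟩ := exists_mem_face hρ hy
  have h1 := hΦ ⟨ρ, hρ⟩ ⟨σ, hσ⟩ h ⟨x, hx'⟩ ⟨y, hy'⟩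
  rw [← HilbertModuleIso.dist_def, transition_eq, transition_eq] at h1
  simp only [barycentricFrame_coe]
  exact h1.trans (mul_le_mul_of_nonneg_left (simplexDist_le_l1Dist _ _ _) hε)

variable {Φ} in
theorem IsFlatFamily.isFlatFrames {ε : ℝ} (hΦ : IsFlatFamily ε Φ) (hε : 0 ≤ ε)
    {Y : Set (Finset ι)} (hY : ∀ σ ∈ Y, σ ∈ X) : IsFlatFrames Y ε (barycentricFrame Φ) :=
  fun σ hσ _ _ hτσ hτ _ hx _ hy =>
    hΦ.dist_le hε ((X.isRelLowerSet_faces (hY σ hσ)).2 hτσ hτ) (hY σ hσ) hτσ hx hy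

variable {Φ} in
theorem IsFlatFamily.mono {ε ε' : ℝ} (hΦ : IsFlatFamily ε Φ) (h : ε ≤ ε') : IsFlatFamily ε' Φ :=
  fun ρ σ hρσ x y =>
    (hΦ ρ σ hρσ x y).trans (mul_le_mul_of_nonneg_right h simplexDist_nonneg)

theorem iso_eq_supportFrame {σ : Finset ι} (hσ : σ ∈ X) {x : X.Realization} (hx : x ∈ face X σ)
    (h : x.1.support = σ) : (Φ ⟨σ, hσ⟩).iso ⟨x, hx⟩ = supportFrame Φ x := by
  subst h
  rfl

theorem support_vertex (p : ι) : (vertex X p).1.support = {p} :=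
  Finsupp.support_single _ one_ne_zero

theorem vertexIso_eq (p : ι) : vertexIso Φ p = supportFrame Φ (vertex X p) :=
  iso_eq_supportFrame Φ _ _ (support_vertex p)

theorem supportFrame_trans_transport [DecidableEq ι] (p q : ι) (h : {p, q} ∈ X) :
    (supportFrame Φ (vertex X p)).trans (transport Φ p q h) =
      (barycentricFrame Φ {p, q} (vertexPoint q) *
        (barycentricFrame Φ {p, q} (vertexPoint p))⁻¹).trans (supportFrame Φ (vertex X q)) := by
  rw [← vertex_coe (X := X), ← vertex_coe (X := X), barycentricFrame_coe, barycentricFrame_coe,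
    frame_of_mem Φ h (vertex_mem_face (by simp)), frame_of_mem Φ h (vertex_mem_face (by simp))]
  ext v
  exact (HilbertModuleIso.apply_symm_apply (supportFrame Φ (vertex X q)) _).symm

/-- At a vertex the reference frame is the trivialization over that vertex, so no further correction
is needed. -/
theorem transportMatrix_eq [DecidableEq ι] (p q : ι) (h : {p, q} ∈ X) :
    transportMatrix Φ p q h = barycentricFrame Φ {p, q} (vertexPoint q) *
      (barycentricFrame Φ {p, q} (vertexPoint p))⁻¹ := by
  rw [transportMatrix, vertexIso_eq, vertexIso_eq, supportFrame_trans_transport]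
  ext v
  exact HilbertModuleIso.symm_apply_apply (supportFrame Φ (vertex X q)) _

/-- The product is the holonomy conjugated by the reference frame at `p`; those at `q` and `r`
cancel. -/
theorem dist_holonomy_one [DecidableEq ι] (p q r : ι) (hpq : {p, q} ∈ X) (hqr : {q, r} ∈ X)
    (hrp : {r, p} ∈ X) :
    dist (barycentricFrame Φ {r, p} (vertexPoint p) *
        (barycentricFrame Φ {r, p} (vertexPoint r))⁻¹ *
        (barycentricFrame Φ {q, r} (vertexPoint r) *
          (barycentricFrame Φ {q, r} (vertexPoint q))⁻¹) *
        (barycentricFrame Φ {p, q} (vertexPoint q) *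
          (barycentricFrame Φ {p, q} (vertexPoint p))⁻¹)) 1 ≤
      ‖(((transport Φ p q hpq).trans (transport Φ q r hqr)).trans (transport Φ r p hrp)).toCLM
        - ContinuousLinearMap.id ℂ _‖ := by
  refine le_trans (le_of_eq ?_) (HilbertModuleIso.norm_conj_sub_id_le
    (supportFrame Φ (vertex X p)) _)
  rw [HilbertModuleIso.dist_def]
  congr 2
  refine congrArg HilbertModuleIso.toCLM ?_
  have h1 := supportFrame_trans_transport Φ p q hpq
  have h2 := supportFrame_trans_transport Φ q r hqr
  have h3 := supportFrame_trans_transport Φ r p hrp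
  have assoc : (supportFrame Φ (vertex X p)).trans
      (((transport Φ p q hpq).trans (transport Φ q r hqr)).trans (transport Φ r p hrp)) =
      (((supportFrame Φ (vertex X p)).trans (transport Φ p q hpq)).trans
        (transport Φ q r hqr)).trans (transport Φ r p hrp) := rfl
  have step : ∀ (g : HilbertModuleIso A V V) (p q : ι) (T : HilbertModuleIso A
      (E.Fiber (vertex X p)) (E.Fiber (vertex X q))), (g.trans (supportFrame Φ (vertex X p))).trans T
        = g.trans ((supportFrame Φ (vertex X p)).trans T) := fun _ _ _ _ => rfl
  have step' : ∀ (g g' : HilbertModuleIso A V V) (p q : ι) (T : HilbertModuleIso A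
      (E.Fiber (vertex X p)) (E.Fiber (vertex X q))),
      (g.trans (g'.trans (supportFrame Φ (vertex X p)))).trans T
        = (g' * g).trans ((supportFrame Φ (vertex X p)).trans T) := fun _ _ _ _ _ => rfl
  rw [assoc, h1, step, h2, step', h3]
  ext v
  exact (HilbertModuleIso.symm_apply_apply (supportFrame Φ (vertex X p)) _).symm

end BarycentricFrames

/-! ### Flat extensions over the next skeleton. -/

section SkeletonExtension

variable {k : ℕ} {E : HilbertModuleBundle A V (X.skeleton k).Realization}
  {Φ : E.TrivializationFamily}

/-- A flat bundle over the `k`-skeleton extends if there are frames at the vertices of each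
`(k + 1)`-simplex which are almost parallel along its edges. -/
theorem exists_flat_extension [CompleteSpace V] [DecidableEq ι] {ε : ℝ} (hε : 0 ≤ ε)
    (hε' : gaugeConst k * ε ≤ 1) (hΦ : IsFlatFamily ε Φ)
    (hedge : ∀ σ ∈ X, σ.card = k + 2 → ∃ γ₀ : ι → HilbertModuleIso A V V,
      ∀ p q, p ≠ q → {p, q} ⊆ σ → {p, q} ∈ X.skeleton k →
        dist ((barycentricFrame Φ {p, q} (vertexPoint p))⁻¹ * γ₀ p)
          ((barycentricFrame Φ {p, q} (vertexPoint q))⁻¹ * γ₀ q) ≤ ε) :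
    ∃ (E' : HilbertModuleBundle A V (X.skeleton (k + 1)).Realization)
      (Φ' : E'.TrivializationFamily), IsFlatFamily (gaugeConst k * (k + 1) * ε) Φ' ∧
        IsExtension (X.skeleton_mono (Nat.le_succ k)) E Φ E' Φ' := by
  have hgauge : ∀ σ, σ ∈ X ∧ σ.card = k + 2 → ∃ γ : (ι → ℝ) → HilbertModuleIso A V V,
      ∀ τ ∈ X.skeleton k, τ ⊆ σ → ∀ x ∈ simplexPoints τ, ∀ y ∈ simplexPoints τ,
        dist ((barycentricFrame Φ τ x)⁻¹ * γ x) ((barycentricFrame Φ τ y)⁻¹ * γ y) ≤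
          gaugeConst k * ε * l1Dist τ x y := by
    rintro σ ⟨hσ, hc⟩
    obtain ⟨γ₀, hγ₀⟩ := hedge σ hσ hc
    -- With `φ = 1`, over the faces of `σ` in the `k`-skeleton, the gauge transformation is a
    -- trivialization of `E` over the boundary of `σ`.
    obtain ⟨γ, -, hγ⟩ := exists_lipschitz_gauge (G := HilbertModuleIso A V V)
      HilbertModuleIso.hasLipschitzChartAtOne (Y := {τ | τ ∈ X.skeleton k ∧ τ ⊆ σ})
      (fun τ hτ ρ hρ hne => ⟨((X.skeleton k).isRelLowerSet_faces hτ.1).2 hρ hne, hρ.trans hτ.2⟩)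
      (fun τ hτ => ((X.skeleton k).isRelLowerSet_faces hτ.1).1) hε
      (φ := fun _ _ => 1) (φ' := barycentricFrame Φ)
      (fun τ _ _ ρ _ _ x _ y _ => by
        rw [dist_self]
        exact mul_nonneg hε l1Dist_nonneg)
      (hΦ.isFlatFrames hε fun τ hτ => hτ.1) γ₀
      (fun p q hpq h => by
        simpa only [mul_one] using hγ₀ p q hpq h.2 h.1) k hε'
    refine ⟨γ, fun τ hτ hτσ x hx y hy => ?_⟩
    simpa only [mul_one] using hγ τ ⟨hτ, hτσ⟩ hτ.2 x hx y hy
  choose! γ hγ using hgauge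
  have hβ : ∀ σ ∈ X, σ.card = k + 2 → ∀ τ ∈ X.skeleton k, τ ⊆ σ → ∀ x ∈ face _ τ,
      ∀ y ∈ face _ τ, dist ((frame Φ τ x)⁻¹ * γ σ x.1) ((frame Φ τ y)⁻¹ * γ σ y.1) ≤
        gaugeConst k * ε * l1Dist τ x.1 y.1 := by
    intro σ hσ hc τ hτ hτσ x hx y hy
    have := hγ σ ⟨hσ, hc⟩ τ hτ hτσ _ (coe_mem_simplexPoints hx) _ (coe_mem_simplexPoints hy)
    rwa [barycentricFrame_coe, barycentricFrame_coe] at this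
  obtain ⟨E', Φ', hext, htr⟩ := exists_extension Φ (fun σ x => γ σ x.1)
    fun σ hσ hc τ hτ hτσ => continuousOn_of_lipschitz (hβ σ hσ hc τ hτ hτσ)
  refine ⟨E', Φ', fun ρ σ h x y => ?_, hext⟩
  have hC := one_le_gaugeConst k
  rw [← HilbertModuleIso.dist_def, htr, htr]
  have hnn : 0 ≤ gaugeConst k * (k + 1) * ε * simplexDist ρ.1 x.1 y.1 :=
    mul_nonneg (by positivity) simplexDist_nonneg
  by_cases hρc : ρ.1.card ≤ k + 1
  swap
  -- A simplex with `k + 2` vertices is maximal here, so the transition function is the identity.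
  · have hρ := card_eq_of_mem_skeleton_succ ρ.2 hρc
    have hσ := σ.2.2
    have : ρ.1 = σ.1 := Finset.eq_of_subset_of_card_le h (by omega)
    rw [← this]
    simpa using hnn
  have hρ : ρ.1 ∈ X.skeleton k := ⟨ρ.2.1, hρc⟩
  have hret : ∀ z : face (X.skeleton (k + 1)) ρ.1,
      (⇑(skeletonRetraction z.1).1 : ι → ℝ) = z.1.1 ∧
        skeletonRetraction z.1 ∈ face (X.skeleton k) ρ.1 := fun z => by
    have h1 := skeletonRetraction_of_card_le (card_le_of_mem_face z.2 hρc)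
    refine ⟨h1, mem_face_iff.2 fun p hp => ?_⟩
    rw [h1]
    exact mem_face_iff.1 z.2 p hp
  have hdist : simplexDist ρ.1 (skeletonRetraction x.1) (skeletonRetraction y.1) =
      simplexDist ρ.1 x.1 y.1 := by
    rw [simplexDist, (hret x).1, (hret y).1, simplexDist]
  have hcard : (ρ.1.card : ℝ) ≤ k + 1 := by exact_mod_cast hρc
  by_cases hσc : σ.1.card ≤ k + 1
  · simp only [extendedFrame, if_pos hρc, if_pos hσc]
    have h1 := hΦ ⟨ρ.1, hρ⟩ ⟨σ.1, σ.2.1, hσc⟩ h ⟨_, (hret x).2⟩ ⟨_, (hret y).2⟩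
    rw [← HilbertModuleIso.dist_def, transition_eq, transition_eq, hdist] at h1
    refine h1.trans (mul_le_mul_of_nonneg_right ?_ simplexDist_nonneg)
    have : 1 ≤ gaugeConst k * (k + 1) := by nlinarith [Nat.cast_nonneg (α := ℝ) k]
    nlinarith
  -- From an old simplex to a new one, the transition function is the clutching map in the old
  -- frame, bounded by `hβ`.
  · have hσ := card_eq_of_mem_skeleton_succ σ.2 hσc
    have hs := fun z : face (X.skeleton (k + 1)) ρ.1 => card_le_of_mem_face z.2 hρc
    simp only [extendedFrame, if_pos hρc, if_neg hσc, if_pos (hs x), if_pos (hs y)]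
    refine (hβ σ.1 σ.2.1 hσ ρ.1 hρ h _ (hret x).2 _ (hret y).2).trans ?_
    have h2 := l1Dist_le_card_mul_simplexDist ρ.1 (skeletonRetraction x.1) (skeletonRetraction y.1)
    rw [hdist] at h2
    have h3 : (ρ.1.card : ℝ) * simplexDist ρ.1 x.1 y.1 ≤ (k + 1) * simplexDist ρ.1 x.1 y.1 :=
      mul_le_mul_of_nonneg_right hcard simplexDist_nonneg
    calc _ ≤ gaugeConst k * ε * ((k + 1) * simplexDist ρ.1 x.1 y.1) :=
          mul_le_mul_of_nonneg_left (h2.trans h3) (by positivity)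
      _ = _ := by ring

/-- Over a `1`-skeleton every family of trivializations is flat. -/
theorem isFlatFamily_skeleton_one {E : HilbertModuleBundle A V (X.skeleton 1).Realization}
    (Φ : E.TrivializationFamily) {ε : ℝ} (hε : 0 ≤ ε) : IsFlatFamily ε Φ := by
  intro ρ σ h x y
  have hnn : 0 ≤ ε * simplexDist ρ.1 x.1 y.1 := mul_nonneg hε simplexDist_nonneg
  rw [← HilbertModuleIso.dist_def, transition_eq, transition_eq]
  rcases Nat.lt_or_ge ρ.1.card 2 with hc | hc
  · obtain ⟨p, hp⟩ := Finset.card_eq_one.1 (le_antisymm (by omega)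
      (Finset.card_pos.2 ((X.skeleton 1).isRelLowerSet_faces ρ.2).1) : ρ.1.card = 1)
    have hv : ∀ z : face (X.skeleton 1) ρ.1, (⇑z.1.1 : ι → ℝ) = vertexPoint p := fun z =>
      eq_vertexPoint (coe_mem_simplexPoints (hp ▸ z.2))
    have : x.1 = y.1 := Realization.ext fun q => by rw [hv x, hv y]
    rw [this, dist_self]
    rwa [this] at hnn
  · have hσ := σ.2.2
    have : ρ.1 = σ.1 := Finset.eq_of_subset_of_card_le h (by omega)
    rw [← this]
    simpa using hnn

variable (Φ) in
/-- The frame at the vertex `v` obtained by transport from the vertex `o`. -/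
noncomputable def transportedFrame [DecidableEq ι] (o v : ι) : HilbertModuleIso A V V :=
  barycentricFrame Φ {o, v} (vertexPoint v) * (barycentricFrame Φ {o, v} (vertexPoint o))⁻¹

/-- In a flat bundle the frames obtained by transport from a vertex of a simplex are almost
parallel. -/
theorem IsFlatFamily.dist_transportedFrame_le [DecidableEq ι] {ε : ℝ} (hΦ : IsFlatFamily ε Φ)
    (hε : 0 ≤ ε) {o p q : ι} (h : {o, p, q} ∈ X.skeleton k) :
    dist ((barycentricFrame Φ {p, q} (vertexPoint p))⁻¹ * transportedFrame Φ o p)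
      ((barycentricFrame Φ {p, q} (vertexPoint q))⁻¹ * transportedFrame Φ o q) ≤ 6 * ε := by
  -- Each edge is compared with the trivialization over the triangle. Vertices have `ℓ¹`-distance at
  -- most two, so an edge costs `2 * ε` and the three edges `6 * ε`.
  have key : ∀ a b : ι, {a, b} ⊆ ({o, p, q} : Finset ι) →
      dist ((barycentricFrame Φ {a, b} (vertexPoint a))⁻¹ *
        barycentricFrame Φ {o, p, q} (vertexPoint a))
        ((barycentricFrame Φ {a, b} (vertexPoint b))⁻¹ *
        barycentricFrame Φ {o, p, q} (vertexPoint b)) ≤ 2 * ε := by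
    intro a b hab
    have ha : vertexPoint a ∈ simplexPoints {a, b} := vertexPoint_mem (by simp)
    have hb : vertexPoint b ∈ simplexPoints {a, b} := vertexPoint_mem (by simp)
    refine (hΦ.dist_le hε (((X.skeleton k).isRelLowerSet_faces h).2 hab (by simp)) h hab
      ha hb).trans ?_
    have := l1Dist_le_two ha hb
    nlinarith
  have k1 := key p q (by simp)
  have k2 := key o p (by intro x; simp; tauto)
  have k3 := key o q (by intro x; simp; tauto)
  simp only [transportedFrame]
  set S := barycentricFrame Φ {o, p, q}
  set a := fun x => (barycentricFrame Φ {p, q} x)⁻¹ * S x with ha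
  set b := fun x => (barycentricFrame Φ {o, p} x)⁻¹ * S x with hb
  set c := fun x => (barycentricFrame Φ {o, q} x)⁻¹ * S x with hc
  have e1 : (barycentricFrame Φ {p, q} (vertexPoint p))⁻¹ *
      (barycentricFrame Φ {o, p} (vertexPoint p) *
        (barycentricFrame Φ {o, p} (vertexPoint o))⁻¹) =
      a (vertexPoint p) * ((b (vertexPoint p))⁻¹ * b (vertexPoint o)) *
        (S (vertexPoint o))⁻¹ := by
    simp only [ha, hb]
    group
  have e2 : (barycentricFrame Φ {p, q} (vertexPoint q))⁻¹ *
      (barycentricFrame Φ {o, q} (vertexPoint q) *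
        (barycentricFrame Φ {o, q} (vertexPoint o))⁻¹) =
      a (vertexPoint q) * ((c (vertexPoint q))⁻¹ * c (vertexPoint o)) *
        (S (vertexPoint o))⁻¹ := by
    simp only [ha, hc]
    group
  rw [e1, e2, dist_mul_right]
  refine (dist_mul_mul_le_of_biInvariant _ _ _ _).trans ?_
  have d1 : dist ((b (vertexPoint p))⁻¹ * b (vertexPoint o)) 1 ≤ 2 * ε := by
    rw [← dist_mul_left (b (vertexPoint p)), mul_inv_cancel_left, mul_one]
    exact k2
  have d2 : dist 1 ((c (vertexPoint q))⁻¹ * c (vertexPoint o)) ≤ 2 * ε := by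
    rw [← dist_mul_left (c (vertexPoint q)), mul_inv_cancel_left, mul_one, dist_comm]
    exact k3
  have d3 := dist_triangle ((b (vertexPoint p))⁻¹ * b (vertexPoint o)) 1
    ((c (vertexPoint q))⁻¹ * c (vertexPoint o))
  linarith

/-- If the holonomy around a triangle is almost trivial then the frames obtained by transport from a
vertex are almost parallel. -/
theorem dist_transportedFrame_le_of_holonomy [DecidableEq ι]
    {E : HilbertModuleBundle A V (X.skeleton 1).Realization} (Φ : E.TrivializationFamily) {ε : ℝ}
    (hε : 0 ≤ ε)
    (hT : ∀ (p q r : ι) (hpq : {p, q} ∈ X.skeleton 1) (hqr : {q, r} ∈ X.skeleton 1)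
      (hrp : {r, p} ∈ X.skeleton 1), p ≠ q → q ≠ r → r ≠ p → {p, q, r} ∈ X →
      ‖(((transport Φ p q hpq).trans (transport Φ q r hqr)).trans (transport Φ r p hrp)).toCLM
        - ContinuousLinearMap.id ℂ _‖ ≤ ε)
    {o p q : ι} (hpq : p ≠ q) (h : {o, p, q} ∈ X) :
    dist ((barycentricFrame Φ {p, q} (vertexPoint p))⁻¹ * transportedFrame Φ o p)
      ((barycentricFrame Φ {p, q} (vertexPoint q))⁻¹ * transportedFrame Φ o q) ≤ ε := by
  simp only [transportedFrame]
  -- For an edge through `o` the two sides agree exactly, since transport from `o` to itself is `1`.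
  by_cases hop : o = p
  · subst hop
    simpa using hε
  by_cases hoq : o = q
  · subst hoq
    rw [Finset.pair_comm o p]
    simpa using hε
  have hmem : ∀ a b : ι, {a, b} ⊆ ({o, p, q} : Finset ι) → {a, b} ∈ X.skeleton 1 := fun a b hab =>
    ⟨(X.isRelLowerSet_faces h).2 hab (by simp), Finset.card_le_two⟩
  have h1 := hmem o p (by intro x; simp; tauto)
  have h2 := hmem p q (by simp)
  have h3 := hmem q o (by intro x; simp; tauto)
  have key := (dist_holonomy_one Φ o p q h1 h2 h3).trans
    (hT o p q h1 h2 h3 hop hpq (Ne.symm hoq) h)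
  rw [Finset.pair_comm q o] at key
  refine le_trans (le_of_eq ?_) key
  -- Left translation turns the distance of the holonomy from `1` into the defect along the edge
  -- `{p, q}`.
  rw [← dist_mul_left ((barycentricFrame Φ {p, q} (vertexPoint q))⁻¹ *
    (barycentricFrame Φ {o, q} (vertexPoint q) *
        (barycentricFrame Φ {o, q} (vertexPoint o))⁻¹)) _ 1]
  congr 1
  group

end SkeletonExtension

/-! ### Uniqueness of flat bundles with given transports. -/

section Uniqueness

/-- Flat bundles with almost equal transports along the edges are isomorphic by an isomorphism with
Lipschitz local expressions. -/
theorem exists_lipschitz_iso [CompleteSpace V] [DecidableEq ι] {n : ℕ} (hX : X.DimLE n) {ε : ℝ}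
    (hε : 0 ≤ ε) (hε' : gaugeConst n * ε ≤ 1) {E E' : HilbertModuleBundle A V X.Realization}
    {Φ : E.TrivializationFamily} {Φ' : E'.TrivializationFamily} (hΦ : IsFlatFamily ε Φ)
    (hΦ' : IsFlatFamily ε Φ')
    (hT : ∀ (p q : ι) (h : {p, q} ∈ X), p ≠ q →
      ‖(transportMatrix Φ p q h).toCLM - (transportMatrix Φ' p q h).toCLM‖ < ε) :
    ∃ Ξ : IsoOver id E E', ∀ (σ : {σ : Finset ι // σ ∈ X}) (x y : face X σ.1),
      ‖(localExpr Ξ Φ Φ' σ x).toCLM - (localExpr Ξ Φ Φ' σ y).toCLM‖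
        ≤ gaugeConst n * (n + 1) * ε * simplexDist σ.1 x.1 y.1 := by
  obtain ⟨γ, -, hγ⟩ := exists_lipschitz_gauge (G := HilbertModuleIso A V V)
    HilbertModuleIso.hasLipschitzChartAtOne (Y := {τ | τ ∈ X})
    (fun τ hτ ρ hρ hne => (X.isRelLowerSet_faces hτ).2 hρ hne)
    (fun τ hτ => (X.isRelLowerSet_faces hτ).1) hε
    (φ := barycentricFrame Φ) (φ' := barycentricFrame Φ')
    (hΦ.isFlatFrames hε fun _ h => h) (hΦ'.isFlatFrames hε fun _ h => h) 1
    -- For `γ₀ = 1`, left and right translation convert the edge condition into the distance of the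
    -- two transport matrices.
    (fun p q hpq h => by
      have h1 := (hT p q h hpq).le
      rw [← HilbertModuleIso.dist_def, transportMatrix_eq, transportMatrix_eq, dist_comm] at h1
      refine le_trans (le_of_eq ?_) h1
      rw [← dist_mul_left (barycentricFrame Φ' {p, q} (vertexPoint q)),
        ← dist_mul_right _ _ (barycentricFrame Φ {p, q} (vertexPoint p))⁻¹]
      simp only [Pi.one_apply]
      congr 1 <;> group) n hε'
  -- The reference frames and `γ` may jump between cells; continuity follows from the Lipschitz
  -- bounds on the local expressions `hloc`.
  set iso : ∀ x, HilbertModuleIso A (E.Fiber x) (E'.Fiber (id x)) := fun x =>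
    (supportFrame Φ x).symm.trans ((γ x.1).trans (supportFrame Φ' x)) with hiso
  have hloc : ∀ (σ : {σ : Finset ι // σ ∈ X}) (x : face X σ.1),
      (((Φ σ).iso x).trans (iso x)).trans ((Φ' σ).iso x).symm =
        (frame Φ' σ.1 x)⁻¹ * γ x.1.1 * frame Φ σ.1 x := by
    intro σ x
    rw [frame_of_mem Φ σ.2 x.2, frame_of_mem Φ' σ.2 x.2]
    rfl
  have hlip : ∀ σ ∈ X, ∀ x ∈ face X σ, ∀ y ∈ face X σ,
      dist ((frame Φ' σ x)⁻¹ * γ x.1 * frame Φ σ x) ((frame Φ' σ y)⁻¹ * γ y.1 * frame Φ σ y) ≤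
        gaugeConst n * ε * l1Dist σ x.1 y.1 := by
    intro σ hσ x hx y hy
    have := hγ σ hσ (hX σ hσ) _ (coe_mem_simplexPoints hx) _ (coe_mem_simplexPoints hy)
    simpa only [barycentricFrame_coe] using this
  refine ⟨isoOverOfFaces continuous_id iso fun σ hσ =>
    ⟨Φ ⟨σ, hσ⟩, _, Φ' ⟨σ, hσ⟩, fun x => x.2, ?_⟩, fun σ x y => ?_⟩
  · have := continuousOn_iff_continuous_domRestrict.1 (continuousOn_of_lipschitz (hlip σ hσ))
    refine this.congr fun x => ?_
    exact (hloc ⟨σ, hσ⟩ x).symm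
  · have h1 := hlip σ.1 σ.2 x.1 x.2 y.1 y.2
    rw [← hloc, ← hloc, HilbertModuleIso.dist_def] at h1
    refine h1.trans ?_
    have h2 := l1Dist_le_card_mul_simplexDist σ.1 x.1 y.1
    have hcard : (σ.1.card : ℝ) ≤ n + 1 := by exact_mod_cast hX σ.1 σ.2
    have hC := one_le_gaugeConst n
    calc _ ≤ gaugeConst n * ε * ((n + 1) * simplexDist σ.1 x.1 y.1) :=
          mul_le_mul_of_nonneg_left (h2.trans
            (mul_le_mul_of_nonneg_right hcard simplexDist_nonneg)) (by positivity)
      _ = _ := by ring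

end Uniqueness

end HilbertModuleBundle

/-! ### The theorem with explicit constants. -/

theorem mainTheorem7 :
    -- extension from the k-skeleton to the (k+1)-skeleton, k ≠ 1
    (∀ k : ℕ, k ≠ 1 → ∃ C : ℝ, 0 < C ∧ ∃ δ : ℝ, 0 < δ ∧
      ∀ (ι : Type u) (X : AbstractSimplicialComplex ι)
        (A : Type v) [NonUnitalCStarAlgebra A] [PartialOrder A] [StarOrderedRing A]
        (V : Type w) [NormedAddCommGroup V] [NormedSpace ℂ V] [CompleteSpace V] [SMul A V]
        [CStarModule A V], IsFinProjHilbertModule A V →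
      ∀ ε : ℝ, 0 < ε → ε ≤ δ →
      ∀ (E : HilbertModuleBundle A V (X.skeleton k).Realization) (Φ : E.TrivializationFamily),
        HilbertModuleBundle.IsFlatFamily ε Φ →
        ∃ (E' : HilbertModuleBundle A V (X.skeleton (k + 1)).Realization)
          (Φ' : E'.TrivializationFamily),
          HilbertModuleBundle.IsFlatFamily (C * ε) Φ' ∧ HilbertModuleBundle.IsExtension (X.skeleton_mono (Nat.le_succ k)) E Φ E' Φ') ∧
    -- extension from the 1-skeleton to the 2-skeleton
    (∃ C : ℝ, 0 < C ∧ ∃ δ : ℝ, 0 < δ ∧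
      ∀ (ι : Type u) [DecidableEq ι] (X : AbstractSimplicialComplex ι)
        (A : Type v) [NonUnitalCStarAlgebra A] [PartialOrder A] [StarOrderedRing A]
        (V : Type w) [NormedAddCommGroup V] [NormedSpace ℂ V] [CompleteSpace V] [SMul A V]
        [CStarModule A V], IsFinProjHilbertModule A V →
      ∀ ε : ℝ, 0 < ε → ε ≤ δ →
      ∀ (E : HilbertModuleBundle A V (X.skeleton 1).Realization) (Φ : E.TrivializationFamily),
        (∀ (p q r : ι) (hpq : {p, q} ∈ X.skeleton 1) (hqr : {q, r} ∈ X.skeleton 1)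
          (hrp : {r, p} ∈ X.skeleton 1), p ≠ q → q ≠ r → r ≠ p → {p, q, r} ∈ X →
          ‖(((HilbertModuleBundle.transport Φ p q hpq).trans (HilbertModuleBundle.transport Φ q r hqr)).trans (HilbertModuleBundle.transport Φ r p hrp)).toCLM
            - ContinuousLinearMap.id ℂ _‖ ≤ ε) →
        ∃ (E' : HilbertModuleBundle A V (X.skeleton 2).Realization)
          (Φ' : E'.TrivializationFamily),
          HilbertModuleBundle.IsFlatFamily (C * ε) Φ' ∧ HilbertModuleBundle.IsExtension (X.skeleton_mono one_le_two) E Φ E' Φ') ∧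
    -- uniqueness
    (∀ n : ℕ, ∃ C : ℝ, 0 < C ∧ ∃ δ : ℝ, 0 < δ ∧
      ∀ (ι : Type u) [DecidableEq ι] (X : AbstractSimplicialComplex ι), X.DimLE n →
      ∀ (A : Type v) [NonUnitalCStarAlgebra A] [PartialOrder A] [StarOrderedRing A]
        (V : Type w) [NormedAddCommGroup V] [NormedSpace ℂ V] [CompleteSpace V] [SMul A V]
        [CStarModule A V], IsFinProjHilbertModule A V →
      ∀ ε : ℝ, 0 < ε → ε ≤ δ →
      ∀ (E E' : HilbertModuleBundle A V X.Realization)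
        (Φ : E.TrivializationFamily) (Φ' : E'.TrivializationFamily),
        HilbertModuleBundle.IsFlatFamily ε Φ → HilbertModuleBundle.IsFlatFamily ε Φ' →
        (∀ (p q : ι) (h : {p, q} ∈ X), p ≠ q →
          ‖(HilbertModuleBundle.transportMatrix Φ p q h).toCLM - (HilbertModuleBundle.transportMatrix Φ' p q h).toCLM‖ < ε) →
        ∃ Ξ : HilbertModuleBundle.IsoOver id E E', ∀ (σ : {σ : Finset ι // σ ∈ X}) (x y : AbstractSimplicialComplex.Realization.face X σ.1),
          ‖(HilbertModuleBundle.localExpr Ξ Φ Φ' σ x).toCLM - (HilbertModuleBundle.localExpr Ξ Φ Φ' σ y).toCLM‖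
            ≤ C * ε * AbstractSimplicialComplex.Realization.simplexDist σ.1 x.1 y.1) := by
  classical
  have hone := fun k => one_le_gaugeConst k
  -- The `6` is the defect of transport around a triangle in a flat bundle, and each `δ` ensures
  -- `gaugeConst` times the edge defect is at most `1`.
  refine ⟨fun k hk => ⟨gaugeConst k * (k + 1) * 6, ?_, 1 / (6 * gaugeConst k), ?_, ?_⟩,
    ⟨gaugeConst 1 * 2, ?_, 1 / gaugeConst 1, ?_, ?_⟩,
    fun n => ⟨gaugeConst n * (n + 1), ?_, 1 / gaugeConst n, ?_, ?_⟩⟩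
  · have := hone k; positivity
  · have := hone k; positivity
  · intro ι X A _ _ _ V _ _ _ _ _ _ ε hε hδ E Φ hΦ
    have h1 : gaugeConst k * (6 * ε) ≤ 1 := by
      rw [le_div_iff₀ (by have := hone k; positivity)] at hδ
      linarith
    rw [mul_assoc _ 6 ε]
    refine HilbertModuleBundle.exists_flat_extension (by positivity) h1
      (hΦ.mono (by linarith)) fun σ hσ hc => ?_
    obtain ⟨o, ho⟩ : σ.Nonempty := Finset.card_pos.1 (by omega)
    refine ⟨HilbertModuleBundle.transportedFrame Φ o, fun p q hpq hσ' hmem =>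
      hΦ.dist_transportedFrame_le hε.le ⟨(X.isRelLowerSet_faces hσ).2
        (Finset.insert_subset ho hσ') (by simp), ?_⟩⟩
    -- An edge in the `k`-skeleton forces `k ≥ 1`, hence `k ≥ 2` as `k ≠ 1`, so the triangle lies in
    -- the `k`-skeleton. For `k = 0` the condition is vacuous.
    have h2 := hmem.2
    rw [Finset.card_pair hpq] at h2
    have h3 := Finset.card_le_three (a := o) (b := p) (c := q)
    omega
  · have := hone 1; positivity
  · have := hone 1; positivity
  · intro ι _ X A _ _ _ V _ _ _ _ _ _ ε hε hδ E Φ hT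
    have h1 : gaugeConst 1 * ε ≤ 1 := by
      rw [le_div_iff₀ (by have := hone 1; positivity)] at hδ
      linarith
    have h2 : gaugeConst 1 * 2 * ε = gaugeConst 1 * ((1 : ℕ) + 1) * ε := by norm_num
    rw [h2]
    refine HilbertModuleBundle.exists_flat_extension hε.le h1
      (HilbertModuleBundle.isFlatFamily_skeleton_one Φ hε.le) fun σ hσ hc => ?_
    obtain ⟨o, ho⟩ : σ.Nonempty := Finset.card_pos.1 (by omega)
    exact ⟨HilbertModuleBundle.transportedFrame Φ o, fun p q hpq hσ' _ =>
      HilbertModuleBundle.dist_transportedFrame_le_of_holonomy Φ hε.le hT hpq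
        ((X.isRelLowerSet_faces hσ).2 (Finset.insert_subset ho hσ') (by simp))⟩
  · have := hone n; positivity
  · have := hone n; positivity
  · intro ι _ X hX A _ _ _ V _ _ _ _ _ _ ε hε hδ E E' Φ Φ' hΦ hΦ' hT
    have h1 : gaugeConst n * ε ≤ 1 := by
      rw [le_div_iff₀ (by have := hone n; positivity)] at hδ
      linarith
    exact HilbertModuleBundle.exists_lipschitz_iso hX hε.le h1 hΦ hΦ' hT
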